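/- Let $n\ge 0$. Below, for indices $i,j\in\{1,\dots,n\}$, $[i,j]$ denotes the interval of integers between $i$ and $j$, in whichever order they come. Let $Z$ be the ring generated by symbols $z_{i,j}$ $(1\le i,j\le n,\ i\ne j)$ of degree $|z_{i,j}|=-|j-i|$, with relations 1. $z_{j,i}=(-1)^{j-i}z_{i,j}$; 2. $z_{i,j}z_{i',j'}=(-1)^{(j-i)(j'-i')}z_{i+j-i',\,i+j-j'}\,z_{i,j}$ if $[i',j']\subseteq[i,j]$; 3. $z_{i,j}z_{i',j'}=(-1)^{(j-i)(j'-i')}z_{i',j'}z_{i,j}$ if $[i,j]\cap[i',j']=\varnothing$; 4. $z_{i,j}z_{i',j'}=0$ if $[i,j]$ and $[i',j']$ meet but neither contains the other. Let $X$ (the signed nilcactus algebra) be the ring generated by symbols $X_{i,j}$ $(1\le i,j\le n)$ of degree $|X_{i,j}|=|j-i|-1$, with relations 1. $X_{j,i}=(-1)^{j-i}X_{i,j}$, $X_{i,i}=0$; 2. $X_{i,j}^2=0$; 3. $X_{i,j}X_{i',j'}=(-1)^{(j-i-1)(j'-i'-1)}X_{i+j-i',\,i+j-j'}\,X_{i,j}$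 if $[i',j']\subseteq[i,j]$; 4. $X_{i,j}X_{i',j'}=(-1)^{(j-i-1)(j'-i'-1)}X_{i',j'}X_{i,j}$ if $[i,j]\cap[i',j']=\varnothing$. Take the $z_{i,j}$ and the $X_{i,j}$ with $i<j$ as the generators of weight one of $Z$ and $X$. Then $Z$ and $X$ are graded Koszul algebras over $\mathbb{Z}$, graded Koszul dual to each other, with $X_{i,j}$ $(i<j)$ the basis dual to $z_{i,j}$ $(i<j)$; and $X$, like $Z$, is $\mathbb{Z}$-free. Here a ring $A$ with a finite family of generators of weight one, each with an integer degree, is called *graded Koszul* over $\mathbb{Z}$ if it is the direct sum of its components by weight and degree, it is $\mathbb{Z}$-free, it is quadratic, i.e. $A=T(V)/(R)$ with $V$ free on the generators and $R\subseteq V\otimes V$, and the module $\mathbb{Z}$, on which the generators act as zero, has a resolution $\cdots\to P_1\to P_0\to\mathbb{Z}\to0$ by graded free left $A$-modules, with maps preserving weight and degree, in which $P_p$ is generated in weight $p$. Its *graded Koszul dual* is $T(V^*)/(R^\perp)$, where an element of $V^*$ dual to a generator of degree $d$ has degree $-(d+1)$, and $R^\perp\subseteq V^*\otimes V^*$ is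 the annihilator of $R$ for the signed pairing $\langle f\otimes g,v\otimes w\rangle=(-1)^{|v|+(|v|+1)(|w|+1)}f(v)g(w)$, that is, the usual graded pairing after identifying $v\otimes w$ with $(s\otimes s)(v\otimes w)=(-1)^{|v|}sv\otimes sw$, with $s$ the suspension, which raises degrees by one. -/

import Mathlib

namespace KoszulNil

/-- The integer sign `(-1)^e` attached to an integer exponent. -/
def sgn (e : ℤ) : ℤ := (e.negOnePow : ℤˣ)

/-! ### Quadratic algebras over the integers, quadratic duals and Koszulness

Throughout, `z : I → A` is a finite family of elements of a ring `A` (its generators, of weight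
one) and `deg : I → ℤ` gives their internal degrees.  So `A` carries two gradings: the weight
(number of generators in a word) and the internal degree, which is the one that produces signs. -/

section Quadratic

variable {I : Type} [Fintype I] {A : Type} [Ring A]

/-- The homogeneous quadratic expression `∑ c(a,b) z_a z_b`.  The module `I × I → ℤ` is `V ⊗ V` for
`V` the free `ℤ`-module on `I`, the function `c` being the tensor `∑ c(a,b) a ⊗ b`. -/
noncomputable def quadEval (z : I → A) (c : I × I → ℤ) : A :=
  ∑ p : I × I, c p • (z p.1 * z p.2)

/-- The module of all homogeneous quadratic relations satisfied by the family `z`. -/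
noncomputable def quadRelations (z : I → A) : Submodule ℤ (I × I → ℤ) where
  carrier := {c | quadEval z c = 0}
  zero_mem' := by simp [quadEval]
  add_mem' := by
    intro c d hc hd
    change ∑ p : I × I, (c p + d p) • (z p.1 * z p.2) = 0
    change ∑ p : I × I, c p • (z p.1 * z p.2) = 0 at hc
    change ∑ p : I × I, d p • (z p.1 * z p.2) = 0 at hd
    simp only [add_smul, Finset.sum_add_distrib, hc, hd, add_zero]
  smul_mem' := by
    intro k c hc
    change ∑ p : I × I, c p • (z p.1 * z p.2) = 0 at hc
    change ∑ p : I × I, (k • c p) • (z p.1 * z p.2) = 0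
    simp only [smul_assoc, ← Finset.smul_sum, hc, smul_zero]

/-- The relations of the quadratic algebra `T(V)/(R)`. -/
inductive QuadRel (R : Submodule ℤ (I × I → ℤ)) : FreeAlgebra ℤ I → FreeAlgebra ℤ I → Prop
  | mk (r : I × I → ℤ) (hr : r ∈ R) : QuadRel R (quadEval (FreeAlgebra.ι ℤ) r) 0

/-- The quadratic algebra `T(V)/(R)`, for `V` the free `ℤ`-module on `I` and `R ⊆ V ⊗ V`. -/
def QuadAlg (R : Submodule ℤ (I × I → ℤ)) : Type := RingQuot (QuadRel R)

noncomputable instance (R : Submodule ℤ (I × I → ℤ)) : Ring (QuadAlg R) :=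
  inferInstanceAs (Ring (RingQuot (QuadRel R)))

/-- The generators of `T(V)/(R)`. -/
noncomputable def QuadAlg.gen (R : Submodule ℤ (I × I → ℤ)) (a : I) : QuadAlg R :=
  RingQuot.mkRingHom (QuadRel R) (FreeAlgebra.ι ℤ a)

/-- `A` is a quadratic algebra on the generators `z`: the `z a` generate `A`, and all relations
among them are consequences of the homogeneous quadratic ones. -/
def IsQuadratic (z : I → A) : Prop :=
  ∃ e : QuadAlg (quadRelations z) ≃+* A, ∀ a, e (QuadAlg.gen _ a) = z a

/-- The sign with which a tensor `f ⊗ g` of dual elements pairs with `v ⊗ w`, where `|v| = p` and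
`|w| = q`.  The factor `(-1)^p` comes from identifying `v ⊗ w` with `sv ⊗ sw`, where `s` is the
suspension, which raises degrees by one: `(s ⊗ s)(v ⊗ w) = (-1)^|v| sv ⊗ sw`.  The second factor
is the usual sign `⟨f ⊗ g, sv ⊗ sw⟩ = (-1)^(|g||sv|) f(sv) g(sw)`. -/
def koszulSign (p q : ℤ) : ℤ := sgn p * sgn ((q + 1) * (p + 1))

/-- The perpendicular space of `R ⊆ V ⊗ V` inside `V* ⊗ V*` for the graded pairing.  Elements of
`V* ⊗ V*` are written in the basis dual to that of `V`. -/
def perp (deg : I → ℤ) (R : Submodule ℤ (I × I → ℤ)) : Submodule ℤ (I × I → ℤ) where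
  carrier := {f | ∀ r ∈ R, ∑ p : I × I, koszulSign (deg p.1) (deg p.2) * f p * r p = 0}
  zero_mem' := by simp
  add_mem' := by
    intro f g hf hg r hr
    have h1 := hf r hr
    have h2 := hg r hr
    simp only [Pi.add_apply, mul_add, add_mul, Finset.sum_add_distrib, h1, h2, add_zero]
  smul_mem' := by
    intro k f hf r hr
    have h1 := hf r hr
    have h2 : ∀ p : I × I, koszulSign (deg p.1) (deg p.2) * (k • f) p * r p
        = k * (koszulSign (deg p.1) (deg p.2) * f p * r p) := by
      intro p
      simp only [Pi.smul_apply, smul_eq_mul]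
      ring
    simp only [h2, ← Finset.mul_sum, h1, mul_zero]

/-- `B`, with generators `x` of degrees `deg'`, is the graded Koszul dual of `A`, with generators
`z` of degrees `deg`: `B` is the quadratic algebra `T(V*)/(R^⊥)`, where `R` is the module of
quadratic relations of `A`, in such a way that `x` is the basis of `V*` dual to `z`.  The dual of a
generator of degree `d` has degree `-(d + 1)`, as it is dual to the suspended generator. -/
def IsKoszulDual {B : Type} [Ring B] (z : I → A) (deg : I → ℤ) (x : I → B) (deg' : I → ℤ) : Prop :=
  (∀ a, deg' a = -(deg a + 1)) ∧
    ∃ e : QuadAlg (perp deg (quadRelations z)) ≃+* B, ∀ a, e (QuadAlg.gen _ a) = x a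

/-- The component of weight `wd.1` and internal degree `wd.2`: the span of the words of this length
and degree in the generators. -/
def component (z : I → A) (deg : I → ℤ) (wd : ℕ × ℤ) : Submodule ℤ A :=
  Submodule.span ℤ
    {x | ∃ l : List I, l.length = wd.1 ∧ (l.map deg).sum = wd.2 ∧ x = (l.map z).prod}

/-- The trivial left `A`-module `ℤ` (all generators act as zero) has a linear free resolution
`⋯ → P₂ → P₁ → P₀ → ℤ → 0`: here `P_p` is the free left `A`-module on a set `B p` of generators of
weight `p` and of internal degrees `δ p`, and all maps preserve both gradings.  So the matrix
entries of the differentials have weight one, that is, they are linear combinations of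
generators of `A`. -/
def HasLinearResolution (z : I → A) (deg : I → ℤ) : Prop :=
  ∃ ε : A →+* ℤ, (∀ a, ε (z a) = 0) ∧
  ∃ (B : ℕ → Type) (δ : ∀ p, B p → ℤ)
    (d : ∀ p, (B (p + 1) →₀ A) →ₗ[A] (B p →₀ A)) (aug : (B 0 →₀ A) →ₛₗ[ε] ℤ),
    Function.Surjective aug ∧
    Function.Exact (d 0) aug ∧
    (∀ p, Function.Exact (d (p + 1)) (d p)) ∧
    (∀ b, δ 0 b ≠ 0 → aug (Finsupp.single b 1) = 0) ∧
    (∀ p b c, d p (Finsupp.single b 1) c ∈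
      Submodule.span ℤ (z '' {a | deg a = δ (p + 1) b - δ p c}))

/-- `A` is a graded Koszul algebra over `ℤ` on the generators `z` of weight one and internal
degrees `deg`. -/
structure IsKoszul (z : I → A) (deg : I → ℤ) : Prop where
  /-- `A` is the direct sum of its components (weight, internal degree). -/
  graded : DirectSum.IsInternal (component z deg)
  /-- `A` is free over the ground ring. -/
  free : Module.Free ℤ A
  /-- `A` is a quadratic algebra. -/
  quadratic : IsQuadratic z
  /-- The trivial module has a linear resolution. -/
  resolution : HasLinearResolution z deg

end Quadratic

/-! ### The ring `Z` and the signed nilcactus algebra `X`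

The indices `1, …, n` are represented by `Fin n`, and `[i,j]` is the interval of indices between
`i` and `j`, in whichever order they come (`Set.uIcc i j`).  All formulas below depend only on
differences, apart from the reflections `k = i + j - i'` and `l = i + j - j'`, which are written
`k + i' = i + j` and `l + j' = i + j` and are not affected by shifting all the indices. -/

/-- Pairs of distinct indices. -/
abbrev DistinctPair (n : ℕ) : Type := {p : Fin n × Fin n // p.1 ≠ p.2}

/-- Pairs of indices `i < j`. -/
abbrev IncPair (n : ℕ) : Type := {p : Fin n × Fin n // p.1 < p.2}

/-- The symbol `z_{i,j}` in the free algebra. -/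
noncomputable def zSym {n : ℕ} (i j : Fin n) (h : i ≠ j) : FreeAlgebra ℤ (DistinctPair n) :=
  FreeAlgebra.ι ℤ ⟨(i, j), h⟩

/-- The defining relations of `Z`. -/
inductive ZRel (n : ℕ) :
    FreeAlgebra ℤ (DistinctPair n) → FreeAlgebra ℤ (DistinctPair n) → Prop
  /-- `z_{j,i} = (-1)^(j-i) z_{i,j}`. -/
  | reversal (i j : Fin n) (h : i ≠ j) :
      ZRel n (zSym j i h.symm) (sgn ((j : ℤ) - i) • zSym i j h)
  /-- `z_{i,j} z_{i',j'} = (-1)^((j-i)(j'-i')) z_{i+j-i',i+j-j'} z_{i,j}` if `[i',j'] ⊆ [i,j]`. -/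
  | reflection (i j i' j' k l : Fin n) (h : i ≠ j) (h' : i' ≠ j') (hkl : k ≠ l)
      (hsub : Set.uIcc i' j' ⊆ Set.uIcc i j)
      (hk : (k : ℕ) + i' = i + j) (hl : (l : ℕ) + j' = i + j) :
      ZRel n (zSym i j h * zSym i' j' h')
        (sgn (((j : ℤ) - i) * ((j' : ℤ) - i')) • (zSym k l hkl * zSym i j h))
  /-- `z_{i,j} z_{i',j'} = (-1)^((j-i)(j'-i')) z_{i',j'} z_{i,j}` if the intervals are disjoint. -/
  | disjoint (i j i' j' : Fin n) (h : i ≠ j) (h' : i' ≠ j')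
      (hdisj : Disjoint (Set.uIcc i j) (Set.uIcc i' j')) :
      ZRel n (zSym i j h * zSym i' j' h')
        (sgn (((j : ℤ) - i) * ((j' : ℤ) - i')) • (zSym i' j' h' * zSym i j h))
  /-- `z_{i,j} z_{i',j'} = 0` if the intervals overlap and neither is contained in the other. -/
  | overlap (i j i' j' : Fin n) (h : i ≠ j) (h' : i' ≠ j')
      (hmeet : ¬ Disjoint (Set.uIcc i j) (Set.uIcc i' j'))
      (hsub : ¬ Set.uIcc i' j' ⊆ Set.uIcc i j) (hsup : ¬ Set.uIcc i j ⊆ Set.uIcc i' j') :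
      ZRel n (zSym i j h * zSym i' j' h') 0

/-- The ring `Z`. -/
def Z (n : ℕ) : Type := RingQuot (ZRel n)

noncomputable instance (n : ℕ) : Ring (Z n) := inferInstanceAs (Ring (RingQuot (ZRel n)))

/-- The generator `z_{i,j}` of `Z`. -/
noncomputable def zGen {n : ℕ} (i j : Fin n) (h : i ≠ j) : Z n :=
  RingQuot.mkRingHom (ZRel n) (zSym i j h)

/-- The (homological) degree `|z_{i,j}| = -|j - i|`. -/
def zDegree {n : ℕ} (i j : Fin n) : ℤ := -|(j : ℤ) - i|

/-- The symbol `X_{i,j}` in the free algebra. -/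
noncomputable def xSym {n : ℕ} (i j : Fin n) : FreeAlgebra ℤ (Fin n × Fin n) :=
  FreeAlgebra.ι ℤ (i, j)

/-- The defining relations of the signed nilcactus algebra `X`. -/
inductive XRel (n : ℕ) :
    FreeAlgebra ℤ (Fin n × Fin n) → FreeAlgebra ℤ (Fin n × Fin n) → Prop
  /-- `X_{j,i} = (-1)^(j-i) X_{i,j}`. -/
  | reversal (i j : Fin n) : XRel n (xSym j i) (sgn ((j : ℤ) - i) • xSym i j)
  /-- `X_{i,i} = 0`. -/
  | diagonal (i : Fin n) : XRel n (xSym i i) 0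
  /-- `X_{i,j}² = 0`. -/
  | square (i j : Fin n) : XRel n (xSym i j ^ 2) 0
  /-- `X_{i,j} X_{i',j'} = (-1)^((j-i-1)(j'-i'-1)) X_{i+j-i',i+j-j'} X_{i,j}` if
  `[i',j'] ⊆ [i,j]`. -/
  | reflection (i j i' j' k l : Fin n) (hsub : Set.uIcc i' j' ⊆ Set.uIcc i j)
      (hk : (k : ℕ) + i' = i + j) (hl : (l : ℕ) + j' = i + j) :
      XRel n (xSym i j * xSym i' j')
        (sgn (((j : ℤ) - i - 1) * ((j' : ℤ) - i' - 1)) • (xSym k l * xSym i j))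
  /-- `X_{i,j} X_{i',j'} = (-1)^((j-i-1)(j'-i'-1)) X_{i',j'} X_{i,j}` if the intervals are
  disjoint. -/
  | disjoint (i j i' j' : Fin n) (hdisj : Disjoint (Set.uIcc i j) (Set.uIcc i' j')) :
      XRel n (xSym i j * xSym i' j')
        (sgn (((j : ℤ) - i - 1) * ((j' : ℤ) - i' - 1)) • (xSym i' j' * xSym i j))

/-- The signed nilcactus algebra `X`. -/
def X (n : ℕ) : Type := RingQuot (XRel n)

noncomputable instance (n : ℕ) : Ring (X n) := inferInstanceAs (Ring (RingQuot (XRel n)))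

/-- The generator `X_{i,j}` of `X`. -/
noncomputable def xGen {n : ℕ} (i j : Fin n) : X n := RingQuot.mkRingHom (XRel n) (xSym i j)

/-- The degree `|X_{i,j}| = |j - i| - 1`. -/
def xDegree {n : ℕ} (i j : Fin n) : ℤ := |(j : ℤ) - i| - 1

/-- The generators `z_{i,j}` of `Z` with `i < j`. -/
noncomputable def zInc (n : ℕ) (p : IncPair n) : Z n := zGen p.1.1 p.1.2 p.2.ne

/-- The degrees of the generators `z_{i,j}` with `i < j`. -/
def zIncDegree (n : ℕ) (p : IncPair n) : ℤ := zDegree p.1.1 p.1.2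

/-- The generators `X_{i,j}` of `X` with `i < j`. -/
noncomputable def xInc (n : ℕ) (p : IncPair n) : X n := xGen p.1.1 p.1.2

/-- The degrees of the generators `X_{i,j}` with `i < j`. -/
def xIncDegree (n : ℕ) (p : IncPair n) : ℤ := xDegree p.1.1 p.1.2

end KoszulNil

/-! The algebras `Z` and `X` are two instances of one construction. Read a word `a b c …` of
intervals as a sequence of subsets of the index set: the support of `a`, the support of `b` moved by
the reflection of `a`, the support of `c` moved by both reflections, and so on. The reflection and
disjointness relations then become a single rule: two adjacent subsets that are distinct and laminar
(nested or disjoint) may be swapped, up to a sign that is symmetric in the two subsets and invariant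
under permutations of the indices. Up to signs, words modulo these exchanges thus behave like a
partially commutative monoid. A pair of adjacent letters is either exchangeable, or equal, or
non-laminar; `Z` kills the non-laminar pairs and `X` the equal ones. This complementarity, with a
comparison of signs, gives the duality (`perp_relations`).

A monomial basis comes first. The exchange signs are coherent because the sign of a word can be
defined by counting inversions among its commuting supports, so the algebra acts from the right on
the free module on classes of nonzero words; acting on the empty word gives coordinates
(`exists_coords`). Freeness, the bigrading and the exact list of quadratic relations follow.

The combinatorial core is `Equiv.exchangeable`: equivalent words ending in different letters both
arise, up to equivalence of prefixes, from one exchange of the last two letters. It yields right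
cancellation and, for a nonzero word `u`, the criterion for `u a` to vanish (`isNull_cons_iff`).
Hence left ideals generated by generators are spanned by words, and the colon of such an ideal by a
further generator is again generated by generators (`Presents.hasColons`).

This colon property implies Koszulness. Order the generators and filter the augmentation ideal by
them; each successive quotient is cyclic, with annihilator generated by generators. Each generator
of such an annihilator lifts to a linear syzygy, and the lexicographically ordered family of these
syzygies has the same property. Iteration gives the linear resolution
(`hasLinearResolution_of_hasColons`). -/

namespace KoszulNil

/-! ### Linear resolutions from colon ideals generated by generators -/

section Resolution

variable {I A : Type} [Ring A]

/-- The left ideals generated by sets of generators are closed under taking colons by a further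
generator. -/
def HasColons (z : I → A) : Prop :=
  ∀ (S : Set I) (a : I), a ∉ S → ∃ S' : Set I, ∀ w : A,
    w * z a ∈ Submodule.span A (z '' S) ↔ w ∈ Submodule.span A (z '' S')

/-- Projections to the components of a given weight and degree, as far as right multiplication
by generators is concerned. -/
structure HomogeneousProj (z : I → A) (deg : I → ℤ) where
  proj : ℕ → ℤ → A →+ A
  proj_mul : ∀ k e a x, proj (k + 1) (e + deg a) (x * z a) = proj k e x * z a
  proj_one_mem : ∀ e x, proj 1 e x ∈ Submodule.span ℤ (z '' {a | deg a = e})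
  proj_gen : ∀ a, proj 1 (deg a) (z a) = z a

theorem HomogeneousProj.proj_mul_mem {z : I → A} {deg : I → ℤ} (π : HomogeneousProj z deg)
    (k : ℕ) (e f : ℤ) (x : A) {y : A} (hy : y ∈ Submodule.span ℤ (z '' {a | deg a = f})) :
    π.proj (k + 1) (e + f) (x * y) = π.proj k e x * y := by
  induction hy using Submodule.span_induction with
  | mem y hy =>
    obtain ⟨a, rfl, rfl⟩ := hy
    exact π.proj_mul k e a x
  | zero => simp
  | add y y' _ _ h h' => rw [mul_add, mul_add, map_add, h, h']
  | smul m y _ h => rw [mul_smul_comm, mul_smul_comm, map_zsmul, h]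

/-- A finite ordered family of vectors with linear homogeneous entries in a free module, such that
each vector modulo the preceding ones is annihilated by an ideal generated by generators. -/
structure TriangularFamily (z : I → A) (deg : I → ℤ) where
  C : Type
  B : Type
  [order : LinearOrder B]
  [finite : Finite B]
  degC : C → ℤ
  degB : B → ℤ
  v : B → C →₀ A
  linear : ∀ b c, v b c ∈ Submodule.span ℤ (z '' {a | deg a = degB b - degC c})
  colon : ∀ b, ∃ S : Set I, ∀ w : A,
    w • v b ∈ Submodule.span A (v '' Set.Iio b) ↔ w ∈ Submodule.span A (z '' S)

attribute [instance] TriangularFamily.order TriangularFamily.finite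

namespace TriangularFamily

variable {z : I → A} {deg : I → ℤ} (T : TriangularFamily z deg)

/-- The generators of the annihilator of `T.v b` modulo the preceding vectors. -/
noncomputable def ann (b : T.B) : Set I := (T.colon b).choose

theorem smul_mem_iff (b : T.B) (w : A) :
    w • T.v b ∈ Submodule.span A (T.v '' Set.Iio b) ↔ w ∈ Submodule.span A (z '' T.ann b) :=
  (T.colon b).choose_spec w

/-- A generator of the annihilator of `T.v b` modulo the preceding vectors lifts to a syzygy with
leading coefficient `z a` at `b`. Homogeneity allows the remaining coefficients to be chosen linear.
-/
theorem exists_linear_syzygy (π : HomogeneousProj z deg) (b : T.B) (a : I) (ha : a ∈ T.ann b) :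
    ∃ l : T.B →₀ A, l b = z a ∧ (∀ j, b < j → l j = 0) ∧
      Finsupp.linearCombination A T.v l = 0 ∧
      ∀ j, l j ∈ Submodule.span ℤ (z '' {a' | deg a' = deg a + T.degB b - T.degB j}) := by
  classical
  have h : z a • T.v b ∈ Submodule.span A (T.v '' Set.Iio b) :=
    (T.smul_mem_iff b _).2 (Submodule.subset_span ⟨a, ha, rfl⟩)
  obtain ⟨l, hl, hlv⟩ := (Finsupp.mem_span_image_iff_linearCombination A).1 h
  have hl0 : ∀ j, b ≤ j → l j = 0 := by
    intro j hj
    by_contra hne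
    exact absurd ((Finsupp.mem_supported A l).1 hl (Finsupp.mem_support_iff.2 hne)) (not_lt.2 hj)
  have : Fintype T.B := Fintype.ofFinite _
  -- The coefficients `l` may be inhomogeneous. Their components of weight one and of the
  -- appropriate degree satisfy the same equation, since the entries of the vectors are linear: it
  -- is the weight-two part of the original one.
  let m : T.B →₀ A := Finsupp.equivFunOnFinite.symm
    fun j => π.proj 1 (deg a + T.degB b - T.degB j) (l j)
  have hm : ∀ j, m j = π.proj 1 (deg a + T.degB b - T.degB j) (l j) := fun j => rfl
  have hmv : Finsupp.linearCombination A T.v m = z a • T.v b := by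
    ext c
    have hc := DFunLike.congr_fun hlv c
    rw [Finsupp.linearCombination_apply, Finsupp.sum_fintype _ (fun i x => x • T.v i) (fun _ => zero_smul _ _),
      Finsupp.finsetSum_apply] at hc ⊢
    simp only [Finsupp.smul_apply, smul_eq_mul] at hc ⊢
    have h2 := congrArg (π.proj 2 (deg a + (T.degB b - T.degC c))) hc
    rw [π.proj_mul_mem 1 _ _ _ (T.linear b c), π.proj_gen, map_sum] at h2
    rw [← h2]
    refine Finset.sum_congr rfl fun j _ => ?_
    rw [hm, ← π.proj_mul_mem 1 _ _ _ (T.linear j c)]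
    congr 2
    ring
  refine ⟨Finsupp.single b (z a) - m, ?_, ?_, ?_, ?_⟩
  · simp [hm, hl0 b le_rfl]
  · intro j hj
    simp [hm, hl0 j hj.le, hj.ne]
  · rw [map_sub, Finsupp.linearCombination_single, hmv, sub_self]
  · intro j
    rw [Finsupp.sub_apply]
    refine sub_mem ?_ (π.proj_one_mem _ _)
    rw [Finsupp.single_apply]
    split_ifs with hj
    · subst hj
      exact Submodule.subset_span ⟨a, by simp, rfl⟩
    · exact zero_mem _

/-- The index type of the next family in the resolution. -/
abbrev SyzygyIndex [LinearOrder I] : Type :=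
  {p : T.B ×ₗ I // (ofLex p).2 ∈ T.ann (ofLex p).1}

variable [LinearOrder I] (π : HomogeneousProj z deg)

/-- The linear syzygy `z_a e_b - ∑_{j < b} c_j e_j`. -/
noncomputable def syzygy (p : T.SyzygyIndex) : T.B →₀ A :=
  (T.exists_linear_syzygy π (ofLex p.1).1 (ofLex p.1).2 p.2).choose

theorem syzygy_spec (p : T.SyzygyIndex) :
    T.syzygy π p (ofLex p.1).1 = z (ofLex p.1).2 ∧
    (∀ j, (ofLex p.1).1 < j → T.syzygy π p j = 0) ∧
    Finsupp.linearCombination A T.v (T.syzygy π p) = 0 ∧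
    ∀ j, T.syzygy π p j ∈ Submodule.span ℤ
      (z '' {a' | deg a' = deg (ofLex p.1).2 + T.degB (ofLex p.1).1 - T.degB j}) :=
  (T.exists_linear_syzygy π (ofLex p.1).1 (ofLex p.1).2 p.2).choose_spec

/-- Lifts the leading coefficient: if `w` is a combination of generators `z a`, the same combination
of the syzygies attached to the pairs `(b, a)` has coefficient `w` at `b`. -/
theorem exists_mem_span_syzygy (b : T.B) {S : Set I} (hS : S ⊆ T.ann b) {w : A}
    (hw : w ∈ Submodule.span A (z '' S)) :
    ∃ g ∈ Submodule.span A (T.syzygy π '' {p | (ofLex p.1).1 = b ∧ (ofLex p.1).2 ∈ S}),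
      g b = w ∧ (∀ j, b < j → g j = 0) ∧ Finsupp.linearCombination A T.v g = 0 := by
  induction hw using Submodule.span_induction with
  | mem x hx =>
    obtain ⟨a, ha, rfl⟩ := hx
    let p : T.SyzygyIndex := ⟨toLex (b, a), hS ha⟩
    obtain ⟨h1, h2, h3, -⟩ := T.syzygy_spec π p
    exact ⟨T.syzygy π p, Submodule.subset_span ⟨p, ⟨rfl, ha⟩, rfl⟩, h1, h2, h3⟩
  | zero => exact ⟨0, zero_mem _, by simp⟩
  | add x y _ _ hx hy =>
    obtain ⟨g, hg, h1, h2, h3⟩ := hx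
    obtain ⟨g', hg', h1', h2', h3'⟩ := hy
    exact ⟨g + g', add_mem hg hg', by simp [h1, h1'], fun j hj => by simp [h2 j hj, h2' j hj],
      by simp [h3, h3']⟩
  | smul c x _ hx =>
    obtain ⟨g, hg, h1, h2, h3⟩ := hx
    exact ⟨c • g, Submodule.smul_mem _ _ hg, by simp [h1], fun j hj => by simp [h2 j hj],
      by simp [h3]⟩

/-- Division with respect to the leading position: the coefficient at `b` annihilates `T.v b` modulo
the preceding vectors, so a combination of the chosen syzygies cancels it. What remains is a syzygy
with an earlier leading position. -/
theorem mem_span_syzygy_of_le (b : T.B) (f : T.B →₀ A)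
    (hf : Finsupp.linearCombination A T.v f = 0) (hb : ∀ j, b < j → f j = 0) :
    f ∈ Submodule.span A (T.syzygy π '' {p | (ofLex p.1).1 ≤ b}) := by
  classical
  induction b using WellFoundedLT.induction generalizing f with
  | ind b ih =>
    have hw : f b ∈ Submodule.span A (z '' T.ann b) := by
      rw [← T.smul_mem_iff]
      have h1 : f b • T.v b = Finsupp.linearCombination A T.v (Finsupp.single b (f b) - f) := by
        rw [map_sub, hf, Finsupp.linearCombination_single, sub_zero]
      rw [h1]
      refine (Finsupp.mem_span_image_iff_linearCombination A).2 ⟨_, ?_, rfl⟩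
      rw [Finsupp.mem_supported]
      intro j hj
      have hj' : (Finsupp.single b (f b) - f) j ≠ 0 := Finsupp.mem_support_iff.1 hj
      by_contra hlt
      rcases (not_lt.1 hlt : b ≤ j).eq_or_lt with rfl | hlt
      · simp at hj'
      · simp [hb j hlt, hlt.ne] at hj'
    obtain ⟨g, hg, h1, h2, h3⟩ := T.exists_mem_span_syzygy π b subset_rfl hw
    have hg' : g ∈ Submodule.span A (T.syzygy π '' {p | (ofLex p.1).1 ≤ b}) :=
      Submodule.span_mono (Set.image_mono fun p hp => hp.1.le) hg
    rw [← sub_add_cancel f g]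
    refine add_mem ?_ hg'
    rcases (f - g).support.eq_empty_or_nonempty with h0 | h0
    · rw [Finsupp.support_eq_empty.1 h0]
      exact zero_mem _
    · have hmax := Finset.max'_mem _ h0
      set j := (f - g).support.max' h0
      have hjb : j < b := by
        by_contra hlt
        have hj' : (f - g) j ≠ 0 := Finsupp.mem_support_iff.1 hmax
        rcases (not_lt.1 hlt : b ≤ j).eq_or_lt with hbj | hlt
        · exact hj' (by rw [← hbj]; simp [h1])
        · exact hj' (by simp [hb j hlt, h2 j hlt])
      refine Submodule.span_mono (Set.image_mono fun p hp => le_trans hp hjb.le)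
        (ih j hjb (f - g) (by simp [hf, h3]) fun i hi => ?_)
      by_contra hne
      exact absurd (Finset.le_max' _ i (Finsupp.mem_support_iff.2 hne)) (not_le.2 hi)

theorem mem_span_syzygy_of_lt (b : T.B) (f : T.B →₀ A)
    (hf : Finsupp.linearCombination A T.v f = 0) (hb : ∀ j, b ≤ j → f j = 0) :
    f ∈ Submodule.span A (T.syzygy π '' {p | (ofLex p.1).1 < b}) := by
  rcases f.support.eq_empty_or_nonempty with h0 | h0
  · rw [Finsupp.support_eq_empty.1 h0]
    exact zero_mem _
  · have hmax := Finsupp.mem_support_iff.1 (Finset.max'_mem _ h0)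
    have hjb : f.support.max' h0 < b := by
      by_contra hlt
      exact hmax (hb _ (not_lt.1 hlt))
    refine Submodule.span_mono (Set.image_mono fun p hp => lt_of_le_of_lt hp hjb)
      (T.mem_span_syzygy_of_le π _ f hf fun i hi => ?_)
    by_contra hne
    exact absurd (Finset.le_max' _ i (Finsupp.mem_support_iff.2 hne)) (not_le.2 hi)

theorem mem_span_range_syzygy (f : T.B →₀ A) (hf : Finsupp.linearCombination A T.v f = 0) :
    f ∈ Submodule.span A (Set.range (T.syzygy π)) := by
  rcases f.support.eq_empty_or_nonempty with h0 | h0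
  · rw [Finsupp.support_eq_empty.1 h0]
    exact zero_mem _
  · refine Submodule.span_mono (Set.image_subset_range _ _)
      (T.mem_span_syzygy_of_le π (f.support.max' h0) f hf fun i hi => ?_)
    by_contra hne
    exact absurd (Finset.le_max' _ i (Finsupp.mem_support_iff.2 hne)) (not_le.2 hi)

/-- Comparing coefficients at the leading position `b` reduces the colon to one inside `A`: syzygies
led by an earlier position vanish at `b`, those led by `b` contribute their generators. Conversely,
a lift of the coefficient differs from `w • T.syzygy π p` by a syzygy supported before `b`, which is
generated by earlier ones. -/
theorem smul_syzygy_mem_iff (p : T.SyzygyIndex) (w : A) :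
    w • T.syzygy π p ∈ Submodule.span A (T.syzygy π '' Set.Iio p) ↔
      w * z (ofLex p.1).2 ∈
        Submodule.span A (z '' {a | a ∈ T.ann (ofLex p.1).1 ∧ a < (ofLex p.1).2}) := by
  set b := (ofLex p.1).1 with hb
  set a := (ofLex p.1).2 with ha
  obtain ⟨h1, h2, h3, -⟩ := T.syzygy_spec π p
  have hlt : ∀ q : T.SyzygyIndex, q < p ↔
      (ofLex q.1).1 < b ∨ (ofLex q.1).1 = b ∧ (ofLex q.1).2 < a := by
    intro q
    rw [← Subtype.coe_lt_coe, Prod.Lex.lt_iff]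
  constructor
  · intro h
    have h' : w * z a = Finsupp.lapply (R := A) b (w • T.syzygy π p) := by
      simp [h1, hb, ha]
    rw [h']
    have h'' := Submodule.mem_map_of_mem (f := Finsupp.lapply (R := A) b) h
    rw [Submodule.map_span] at h''
    refine Submodule.span_le.2 ?_ h''
    rintro _ ⟨_, ⟨q, hq, rfl⟩, rfl⟩
    obtain ⟨k1, k2, -, -⟩ := T.syzygy_spec π q
    rcases (hlt q).1 hq with hq | ⟨hq, hq'⟩
    · simp [k2 b hq]
    · rw [hq] at k1
      simp only [Finsupp.lapply_apply, SetLike.mem_coe, k1]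
      refine Submodule.subset_span ⟨_, ⟨?_, hq'⟩, rfl⟩
      have := q.2
      rwa [hq] at this
  · intro h
    obtain ⟨g, hg, k1, k2, k3⟩ :=
      T.exists_mem_span_syzygy π b (fun _ h => h.1) h
    rw [← sub_add_cancel (w • T.syzygy π p) g]
    refine add_mem ?_ ?_
    · refine Submodule.span_mono (Set.image_mono fun q hq => (hlt q).2 (Or.inl hq))
        (T.mem_span_syzygy_of_lt π b _ (by simp [h3, k3]) fun j hj => ?_)
      rcases hj.eq_or_lt with rfl | hj
      · simp [hb ▸ h1, k1, ha]
      · simp [h2 j hj, k2 j hj]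
    · exact Submodule.span_mono (Set.image_mono fun q hq =>
        (hlt q).2 (Or.inr ⟨hq.1, hq.2.2⟩)) hg

/-- The family of linear syzygies of a triangular family. -/
noncomputable def next [Finite I] (hz : HasColons z) : TriangularFamily z deg where
  C := T.B
  B := T.SyzygyIndex
  finite := Subtype.finite (α := T.B × I)
  degC := T.degB
  degB p := deg (ofLex p.1).2 + T.degB (ofLex p.1).1
  v := T.syzygy π
  linear p j := (T.syzygy_spec π p).2.2.2 j
  colon p := by
    -- The strict inequality keeps the letter itself out of the set, as `HasColons` requires.
    obtain ⟨S, hS⟩ := hz {a | a ∈ T.ann (ofLex p.1).1 ∧ a < (ofLex p.1).2} (ofLex p.1).2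
      (fun h => lt_irrefl _ h.2)
    exact ⟨S, fun w => (T.smul_syzygy_mem_iff π p w).trans (hS w)⟩

theorem exact_syzygy :
    Function.Exact (Finsupp.linearCombination A (T.syzygy π))
      (Finsupp.linearCombination A T.v) := by
  rw [LinearMap.exact_iff, Finsupp.range_linearCombination]
  refine le_antisymm (fun f hf => T.mem_span_range_syzygy π f hf) (Submodule.span_le.2 ?_)
  rintro _ ⟨p, rfl⟩
  exact (T.syzygy_spec π p).2.2.1

/-- The generators of the augmentation ideal. -/
noncomputable def augmentation [Finite I] (hz : HasColons z) : TriangularFamily z deg where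
  C := Unit
  B := I
  degC _ := 0
  degB := deg
  v a := Finsupp.single () (z a)
  linear a _ := Submodule.subset_span ⟨a, by simp, by simp⟩
  colon a := by
    obtain ⟨S, hS⟩ := hz (Set.Iio a) a (lt_irrefl a)
    refine ⟨S, fun w => ?_⟩
    rw [← hS w, Finsupp.smul_single, smul_eq_mul]
    have h1 : (fun a => Finsupp.single () (z a)) '' Set.Iio a =
        Finsupp.lsingle (R := A) () '' (z '' Set.Iio a) := (Set.image_image _ _ _).symm
    rw [h1, ← Submodule.map_span, Submodule.mem_map]
    constructor
    · rintro ⟨x, hx, h⟩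
      rwa [← Finsupp.single_injective () h]
    · exact fun h => ⟨_, h, rfl⟩

end TriangularFamily

open TriangularFamily in
theorem hasLinearResolution_of_hasColons [Finite I] (z : I → A) (deg : I → ℤ)
    (hz : HasColons z) (π : HomogeneousProj z deg) (ε : A →+* ℤ) (hε : ∀ a, ε (z a) = 0)
    (hker : ∀ x, ε x = 0 → x ∈ Submodule.span A (Set.range z)) : HasLinearResolution z deg := by
  classical
  -- Any linear order on the generators serves, since `HasColons` concerns arbitrary sets of them.
  let _ : LinearOrder I := linearOrderOfSTO WellOrderingRel
  let T : ℕ → TriangularFamily z deg := fun p =>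
    Nat.rec (augmentation hz) (fun _ T => T.next π hz) p
  let aug : (Unit →₀ A) →ₛₗ[ε] ℤ :=
    { toFun := fun f => ε (f ())
      map_add' := by simp
      map_smul' := by simp }
  refine ⟨ε, hε, fun p => (T p).C, fun p => (T p).degC,
    fun p => Finsupp.linearCombination A (T p).v, aug, ?_, ?_, ?_, ?_, ?_⟩
  · intro k
    refine ⟨Finsupp.single () (k : A), ?_⟩
    change ε (Finsupp.single () (k : A) ()) = k
    simp
  · intro (f : Unit →₀ A)
    change ε (f ()) = 0 ↔ f ∈ Set.range (Finsupp.linearCombination A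
      (fun a => Finsupp.single () (z a)))
    have happ : ∀ l : I →₀ A, Finsupp.linearCombination A
        (fun a => Finsupp.single () (z a)) l () = l.sum fun a x => x • z a := by
      intro l
      rw [Finsupp.linearCombination_apply, Finsupp.sum, Finsupp.finsetSum_apply, Finsupp.sum]
      simp
    constructor
    · intro hf
      obtain ⟨l, hl⟩ := (Finsupp.mem_span_range_iff_exists_finsupp).1 (hker _ hf)
      exact ⟨l, Finsupp.ext fun _ => (happ l).trans hl⟩
    · rintro ⟨l, rfl⟩
      rw [happ, Finsupp.sum, map_sum]
      simp [hε]
  · intro p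
    exact (T p).exact_syzygy π
  · intro b hb
    exact absurd rfl hb
  · intro p (b : (T p).B) c
    change Finsupp.linearCombination A (T p).v (Finsupp.single b 1) c ∈
      Submodule.span ℤ (z '' {a | deg a = (T p).degB b - (T p).degC c})
    rw [Finsupp.linearCombination_single, one_smul]
    exact (T p).linear b c

end Resolution


/-! ### Words up to exchange of adjacent letters -/

/-- Letters `a` with a support `supp a` in a set acted on by a group, where a word `a b c …` is
read as the sequence of supports `supp a`, `perm a • supp b`, `(perm a * perm b) • supp c`, ….
Adjacent supports which commute can be exchanged by replacing the letters `a b` by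
`fst a b`, `snd a b`. -/
structure Exchange (I S G : Type) [Group G] [MulAction G S] where
  perm : I → G
  supp : I → S
  supp_injective : Function.Injective supp
  Comm : S → S → Prop
  comm_symm : ∀ {A B}, Comm A B → Comm B A
  comm_irrefl : ∀ A, ¬ Comm A A
  comm_smul : ∀ (g : G) {A B}, Comm A B → Comm (g • A) (g • B)
  fst : I → I → I
  snd : I → I → I
  supp_fst : ∀ {a b}, Comm (supp a) (perm a • supp b) → supp (fst a b) = perm a • supp b
  smul_supp_snd : ∀ {a b}, Comm (supp a) (perm a • supp b) →
    perm (fst a b) • supp (snd a b) = supp a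
  perm_mul : ∀ {a b}, Comm (supp a) (perm a • supp b) →
    perm (fst a b) * perm (snd a b) = perm a * perm b

namespace Exchange

variable {I S G : Type} [Group G] [MulAction G S] (D : Exchange I S G)

/-- The letters `a`, `b` can be exchanged in the word `a b`. -/
def CommPair (a b : I) : Prop := D.Comm (D.supp a) (D.perm a • D.supp b)

theorem comm_smul_iff (g : G) {A B : S} : D.Comm (g • A) (g • B) ↔ D.Comm A B :=
  ⟨fun h => by simpa using D.comm_smul g⁻¹ h, D.comm_smul g⟩

variable {D}

theorem CommPair.swap {a b : I} (h : D.CommPair a b) :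
    D.CommPair (D.fst a b) (D.snd a b) := by
  rw [CommPair, D.smul_supp_snd h, D.supp_fst h]
  exact D.comm_symm h

/-- Two exchanges restore the sequence of supports, and the supports determine the letters. -/
theorem CommPair.fst_fst {a b : I} (h : D.CommPair a b) :
    D.fst (D.fst a b) (D.snd a b) = a :=
  D.supp_injective ((D.supp_fst h.swap).trans (D.smul_supp_snd h))

theorem CommPair.snd_snd {a b : I} (h : D.CommPair a b) :
    D.snd (D.fst a b) (D.snd a b) = b := by
  have h1 := D.smul_supp_snd h.swap
  rw [h.fst_fst, D.supp_fst h] at h1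
  exact D.supp_injective (smul_left_cancel _ h1)

theorem CommPair.swap_ne {a b : I} (h : D.CommPair a b) :
    (D.fst a b, D.snd a b) ≠ (a, b) := by
  intro he
  have h1 := D.supp_fst h
  rw [show D.fst a b = a from congrArg Prod.fst he] at h1
  exact D.comm_irrefl (D.supp a) (by rw [CommPair, ← h1] at h; exact h)

variable (D)

/-- One exchange of adjacent letters. Words are written with the last letter first. -/
inductive Step : List I → List I → Prop
  | swap (u : List I) (a b : I) (h : D.CommPair a b) :
      Step (b :: a :: u) (D.snd a b :: D.fst a b :: u)
  | cons (a : I) {u v : List I} : Step u v → Step (a :: u) (a :: v)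

/-- Words which differ by exchanges. -/
abbrev Equiv : List I → List I → Prop := Relation.EqvGen D.Step

variable {D}

theorem Step.length_eq {u v : List I} (h : D.Step u v) : u.length = v.length := by
  induction h with
  | swap => rfl
  | cons a _ ih => simp [ih]

theorem Equiv.lift {α : Type*} {f : List I → α} (hf : ∀ u v, D.Step u v → f u = f v)
    {u v : List I} (h : D.Equiv u v) : f u = f v := by
  induction h with
  | rel u v h => exact hf u v h
  | refl => rfl
  | symm _ _ _ ih => exact ih.symm
  | trans _ _ _ _ _ ih ih' => exact ih.trans ih'

theorem Equiv.length_eq {u v : List I} (h : D.Equiv u v) : u.length = v.length :=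
  h.lift fun _ _ => Step.length_eq

theorem Equiv.refl (u : List I) : D.Equiv u u := Relation.EqvGen.refl u

theorem Equiv.symm {u v : List I} (h : D.Equiv u v) : D.Equiv v u := Relation.EqvGen.symm _ _ h

theorem Equiv.trans {u v w : List I} (h : D.Equiv u v) (h' : D.Equiv v w) : D.Equiv u w :=
  Relation.EqvGen.trans _ _ _ h h'

theorem Equiv.cons (a : I) {u v : List I} (h : D.Equiv u v) : D.Equiv (a :: u) (a :: v) := by
  induction h with
  | rel u v h => exact .rel _ _ (h.cons a)
  | refl => exact .refl _
  | symm _ _ _ ih => exact ih.symm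
  | trans _ _ _ _ _ ih ih' => exact ih.trans ih'

theorem CommPair.equiv {a b : I} (h : D.CommPair a b) (u : List I) :
    D.Equiv (b :: a :: u) (D.snd a b :: D.fst a b :: u) := .rel _ _ (.swap u a b h)

variable (D) in
/-- The possible shapes of a pair of equivalent words: either they end with the same letter, or
their last letters can be exchanged. -/
def Exchangeable (u v : List I) : Prop :=
  (u = [] ∧ v = []) ∨ ∃ a b w x, u = a :: w ∧ v = b :: x ∧
    ((a = b ∧ D.Equiv w x) ∨ ∃ c t, D.CommPair c a ∧ b = D.snd c a ∧
      D.Equiv w (c :: t) ∧ D.Equiv x (D.fst c a :: t))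

theorem Exchangeable.symm {u v : List I} (h : D.Exchangeable u v) : D.Exchangeable v u := by
  rcases h with ⟨rfl, rfl⟩ | ⟨a, b, w, x, rfl, rfl, ⟨rfl, h⟩ | ⟨c, t, h, rfl, h1, h2⟩⟩
  · exact Or.inl ⟨rfl, rfl⟩
  · exact Or.inr ⟨_, _, _, _, rfl, rfl, Or.inl ⟨rfl, h.symm⟩⟩
  · exact Or.inr ⟨_, _, _, _, rfl, rfl, Or.inr ⟨D.fst c a, t, h.swap, h.snd_snd.symm, h2,
      by rwa [h.fst_fst]⟩⟩

theorem Step.exchangeable {u v : List I} (h : D.Step u v) : D.Exchangeable u v := by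
  cases h with
  | swap u a b h =>
    exact Or.inr ⟨_, _, _, _, rfl, rfl, Or.inr ⟨a, u, h, rfl, .refl _, .refl _⟩⟩
  | cons a h => exact Or.inr ⟨_, _, _, _, rfl, rfl, Or.inl ⟨rfl, .rel _ _ h⟩⟩

theorem Exchangeable.refl (u : List I) : D.Exchangeable u u := by
  cases u with
  | nil => exact Or.inl ⟨rfl, rfl⟩
  | cons a u => exact Or.inr ⟨_, _, _, _, rfl, rfl, Or.inl ⟨rfl, .refl _⟩⟩

/-- Three pairwise exchangeable adjacent letters: exchanging the last letter `a` with `c`, and the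
letter obtained with `c'`, amounts to a single exchange after another choice of prefix. -/
theorem exists_exchange_of_hexagon {a c x c' : I} {r : List I} (h : D.CommPair c a)
    (h' : D.CommPair c' (D.snd c a)) (hx : D.CommPair x (D.fst c a))
    (hc' : c' = D.snd x (D.fst c a)) :
    ∃ p s, D.CommPair p a ∧ D.snd c' (D.snd c a) = D.snd p a ∧
      D.Equiv (c :: x :: r) (p :: s) ∧
      D.Equiv (D.fst c' (D.snd c a) :: D.fst x (D.fst c a) :: r) (D.fst p a :: s) := by
  -- After the prefix `r`, the words `x c a`, `x a' b`, `y c' b`, `y b' e` describe three supports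
  -- in the orders XCA, XAC, ACX with the intermediate AXC: the successive orders are XCA, XAC, AXC,
  -- ACX. The other way round the hexagon is XCA, CXA, CAX, ACX, where the last letter changes only
  -- once, in the step CXA to CAX.
  set a' := D.fst c a with ha'
  set b := D.snd c a with hb
  set y := D.fst x a' with hy
  set b' := D.fst c' b with hb'
  set e := D.snd c' b with he
  have s1 : D.supp a' = D.perm c • D.supp a := D.supp_fst h
  have s2 : D.perm a' • D.supp b = D.supp c := D.smul_supp_snd h
  have s3 : D.perm a' * D.perm b = D.perm c * D.perm a := D.perm_mul h
  have s4 : D.supp b' = D.perm c' • D.supp b := D.supp_fst h'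
  have s5 : D.perm b' • D.supp e = D.supp c' := D.smul_supp_snd h'
  have s6 : D.perm b' * D.perm e = D.perm c' * D.perm b := D.perm_mul h'
  have s7 : D.supp y = D.perm x • D.supp a' := D.supp_fst hx
  have s8 : D.perm y • D.supp c' = D.supp x := by rw [hc']; exact D.smul_supp_snd hx
  have s9 : D.perm y * D.perm c' = D.perm x * D.perm a' := by rw [hc']; exact D.perm_mul hx
  have hB : D.perm x • D.supp c = (D.perm x * D.perm a') • D.supp b := by rw [mul_smul, s2]
  have hB' : D.perm y • D.supp b' = D.perm x • D.supp c := by rw [s4, ← mul_smul, s9, hB]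
  -- The remaining exchanges of the hexagon are allowed because the three supports commute pairwise;
  -- the given commutations only have to be moved by group elements.
  have hxc : D.CommPair x c := by
    rw [CommPair, ← s8, ← hB', s4, D.comm_smul_iff]
    exact h'
  have hyb : D.CommPair y b' := by
    rw [CommPair, hB', s7, D.comm_smul_iff, s1]
    exact D.comm_symm h
  have t1 := D.supp_fst hxc
  have t2 := D.smul_supp_snd hxc
  have t3 := D.perm_mul hxc
  have t1' := D.supp_fst hyb
  have t2' := D.smul_supp_snd hyb
  have t3' := D.perm_mul hyb
  have hβ : D.fst y b' = D.fst x c := D.supp_injective (by rw [t1, t1', hB'])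
  rw [hβ] at t2' t3'
  set β := D.fst x c with hβ'
  set p := D.snd x c with hp
  set q := D.snd y b' with hq
  have k1 : D.perm β • D.perm p • D.supp a = D.supp y := by
    rw [← mul_smul, t3, mul_smul, ← s1, s7]
  have hpa : D.CommPair p a := by
    rw [CommPair, ← D.comm_smul_iff (D.perm β), t2, k1, s7]
    exact hx
  have hfst : D.fst p a = q := by
    apply D.supp_injective
    rw [D.supp_fst hpa]
    apply smul_left_cancel (D.perm β)
    rw [k1, t2']
  refine ⟨p, β :: r, hpa, ?_, hxc.equiv r, ?_⟩
  · apply D.supp_injective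
    have := D.smul_supp_snd hpa
    rw [hfst] at this
    apply smul_left_cancel (D.perm q)
    rw [this]
    apply smul_left_cancel (D.perm β)
    rw [← mul_smul, t3', mul_smul, s5, s8, t2]
  · rw [hfst]
    have := hyb.equiv r
    rwa [hβ] at this

/-- Only transitivity needs an argument. If the last letter changes in both steps, the two
descriptions of the prefix of the middle word are equivalent shorter words; by induction on the
length they end in the same letter or in exchangeable ones. In the first case the two exchanges
cancel, in the second the hexagon applies. -/
theorem Equiv.exchangeable {u v : List I} (h : D.Equiv u v) : D.Exchangeable u v := by
  induction hn : u.length using Nat.strong_induction_on generalizing u v with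
  | h n ih =>
    induction h with
    | rel u v h => exact h.exchangeable
    | refl => exact .refl _
    | symm u v h' ihs => exact (ihs ((Equiv.length_eq h').trans hn)).symm
    | trans u v w h h' ih1 ih2 =>
      have e1 := ih1 hn
      have e2 := ih2 ((Equiv.length_eq h).symm.trans hn)
      rcases e1 with ⟨rfl, rfl⟩ | ⟨a, b, w1, w2, rfl, rfl, e1⟩
      · exact e2
      rcases e2 with ⟨h0, -⟩ | ⟨b', e, w2', w3, hb, rfl, e2⟩
      · exact absurd h0 (by simp)
      obtain ⟨rfl, rfl⟩ := List.cons_eq_cons.1 hb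
      refine Or.inr ⟨a, e, w1, w3, rfl, rfl, ?_⟩
      rcases e1 with ⟨rfl, e1⟩ | ⟨c, t, hc, rfl, e1, e1'⟩
      · rcases e2 with ⟨rfl, e2⟩ | ⟨c', t', hc', rfl, e2, e2'⟩
        · exact Or.inl ⟨rfl, e1.trans e2⟩
        · exact Or.inr ⟨c', t', hc', rfl, e1.trans e2, e2'⟩
      · rcases e2 with ⟨rfl, e2⟩ | ⟨c', t', hc', rfl, e2, e2'⟩
        · exact Or.inr ⟨c, t, hc, rfl, e1, e2.symm.trans e1'⟩
        · have hlt : (D.fst c a :: t).length < n := by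
            rw [← hn, List.length_cons, List.length_cons, e1.length_eq]; simp
          rcases ih _ hlt (e1'.symm.trans e2) rfl with ⟨h0, -⟩ | ⟨f, g, s, s', hf, hg, e3⟩
          · exact absurd h0 (by simp)
          obtain ⟨rfl, rfl⟩ := List.cons_eq_cons.1 hf
          obtain ⟨rfl, rfl⟩ := List.cons_eq_cons.1 hg
          rcases e3 with ⟨rfl, e3⟩ | ⟨x, r, hx, rfl, e3, e3'⟩
          · left
            rw [hc.snd_snd]
            rw [hc.fst_fst] at e2'
            exact ⟨rfl, e1.trans ((e3.cons c).trans e2'.symm)⟩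
          · obtain ⟨p, s, hp, he, k1, k2⟩ := exists_exchange_of_hexagon (r := r) hc hc' hx rfl
            exact Or.inr ⟨p, s, hp, he, e1.trans ((e3.cons c).trans k1),
              e2'.trans ((e3'.cons _).trans k2)⟩

theorem Equiv.exchange {a b : I} {u v : List I} (h : D.Equiv (a :: u) (b :: v)) :
    (a = b ∧ D.Equiv u v) ∨ ∃ c t, D.CommPair c a ∧ b = D.snd c a ∧
      D.Equiv u (c :: t) ∧ D.Equiv v (D.fst c a :: t) := by
  rcases h.exchangeable with ⟨h0, -⟩ | ⟨f, g, s, s', hf, hg, h⟩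
  · exact absurd h0 (by simp)
  · obtain ⟨rfl, rfl⟩ := List.cons_eq_cons.1 hf
    obtain ⟨rfl, rfl⟩ := List.cons_eq_cons.1 hg
    exact h

/-- Right cancellation: it suffices to exclude that an exchange reproduces the last letter. In that
case the product of the group elements forces the two supports to coincide, against irreflexivity.
-/
theorem Equiv.of_cons {a : I} {u v : List I} (h : D.Equiv (a :: u) (a :: v)) : D.Equiv u v := by
  rcases h.exchange with ⟨-, h⟩ | ⟨c, t, hc, ha, -, -⟩
  · exact h
  · exfalso
    have h1 := D.perm_mul hc
    have h2 := D.smul_supp_snd hc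
    have h3 := D.supp_fst hc
    rw [← ha] at h1 h2
    rw [mul_right_cancel h1] at h2
    rw [h2] at h3
    rw [CommPair, h2] at hc
    exact D.comm_irrefl _ hc

theorem equiv_singleton {a : I} {u : List I} (h : D.Equiv [a] u) : u = [a] := by
  obtain ⟨b, rfl⟩ := List.length_eq_one_iff.1 h.length_eq.symm
  rcases h.exchange with ⟨rfl, -⟩ | ⟨c, t, -, -, h, -⟩
  · rfl
  · exact absurd h.length_eq (by simp)

theorem equiv_pair {a b c d : I} (h : D.Equiv [b, a] [d, c]) :
    (c = a ∧ d = b) ∨ (D.CommPair a b ∧ c = D.fst a b ∧ d = D.snd a b) := by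
  rcases Equiv.exchange h with ⟨rfl, h1⟩ | ⟨e, t, he, rfl, h, h'⟩
  · left
    simpa using equiv_singleton h1
  · obtain ⟨rfl, rfl⟩ := List.cons_eq_cons.1 (equiv_singleton h)
    right
    have := equiv_singleton h'.symm
    simp_all

variable (D)

/-- The product of the group elements attached to the letters. -/
def state : List I → G
  | [] => 1
  | a :: u => state u * D.perm a

/-- The sequence of supports described by a word. -/
def supports : List I → List S
  | [] => []
  | a :: u => D.state u • D.supp a :: supports u

variable {D}

theorem Step.state_eq {u v : List I} (h : D.Step u v) : D.state u = D.state v := by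
  induction h with
  | swap u a b h => simp only [state, mul_assoc, D.perm_mul h]
  | cons a h ih => simp only [state, ih]

theorem Equiv.state_eq {u v : List I} (h : D.Equiv u v) : D.state u = D.state v :=
  h.lift fun _ _ => Step.state_eq

theorem supports_fst_snd {a b : I} (h : D.CommPair a b) (u : List I) :
    D.supports (D.snd a b :: D.fst a b :: u) =
      D.state u • D.supp a :: D.state u • (D.perm a • D.supp b) :: D.supports u := by
  simp only [supports, state, mul_smul, D.smul_supp_snd h, D.supp_fst h]

theorem supports_cons_cons (a b : I) (u : List I) :
    D.supports (b :: a :: u) =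
      D.state u • (D.perm a • D.supp b) :: D.state u • D.supp a :: D.supports u := by
  simp only [supports, state, mul_smul]

theorem Step.supports_perm {u v : List I} (h : D.Step u v) :
    (D.supports u).Perm (D.supports v) := by
  induction h with
  | swap u a b h =>
    rw [supports_fst_snd h, supports_cons_cons]
    exact List.Perm.swap _ _ _
  | cons a h ih =>
    simp only [supports, h.state_eq]
    exact ih.cons _

theorem Equiv.supports_perm {u v : List I} (h : D.Equiv u v) :
    (D.supports u).Perm (D.supports v) := by
  induction h with
  | rel u v h => exact h.supports_perm
  | refl => exact .refl _
  | symm _ _ _ ih => exact ih.symm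
  | trans _ _ _ _ _ ih ih' => exact ih.trans ih'

variable (D)

/-! ### Signs and vanishing of words -/

/-- Signs for the exchanges, and pairs of supports whose product vanishes. -/
structure Twist where
  sign : S → S → ℤˣ
  sign_symm : ∀ A B, sign A B = sign B A
  sign_smul : ∀ (g : G) A B, sign (g • A) (g • B) = sign A B
  Null : S → S → Prop
  null_smul : ∀ (g : G) A B, Null A B → Null (g • A) (g • B)
  not_comm_of_null : ∀ A B, Null A B → ¬ D.Comm A B
  comm_or_null : ∀ {A B C}, Null A B → D.Comm C B → D.Comm A C ∨ Null A C

namespace Twist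

variable {D} (W : D.Twist)

/-- The product of the letters `a`, `b` vanishes. -/
def NullPair (a b : I) : Prop := W.Null (D.supp a) (D.perm a • D.supp b)

/-- The sign of the exchange of the word `a b`. -/
def pairSign (a b : I) : ℤˣ := W.sign (D.supp a) (D.perm a • D.supp b)

theorem null_smul_iff (g : G) {A B : S} : W.Null (g • A) (g • B) ↔ W.Null A B :=
  ⟨fun h => by simpa using W.null_smul g⁻¹ _ _ h, W.null_smul g _ _⟩

theorem pairSign_swap {a b : I} (h : D.CommPair a b) :
    W.pairSign (D.fst a b) (D.snd a b) = W.pairSign a b := by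
  rw [pairSign, D.smul_supp_snd h, D.supp_fst h, W.sign_symm, pairSign]

theorem not_commPair {a b : I} (h : W.NullPair a b) : ¬ D.CommPair a b :=
  W.not_comm_of_null _ _ h

open Classical in
/-- The sign of a pair of supports occurring in this order, for an auxiliary well-ordering. -/
noncomputable def inversionSign (A B : S) : ℤˣ :=
  if D.Comm A B ∧ WellOrderingRel B A then W.sign A B else 1

theorem inversionSign_mul {A B : S} (h : D.Comm A B) :
    W.inversionSign A B = W.sign A B * W.inversionSign B A := by
  have hne : A ≠ B := fun he => D.comm_irrefl B (he ▸ h)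
  rcases trichotomous_of WellOrderingRel A B with hlt | rfl | hlt
  · have h1 : ¬ WellOrderingRel B A := fun hlt' => asymm_of WellOrderingRel hlt hlt'
    simp only [inversionSign, h, h1, and_false, if_false, D.comm_symm h, hlt, and_self, if_true]
    rw [W.sign_symm B A, Int.units_mul_self]
  · exact absurd rfl hne
  · have h1 : ¬ WellOrderingRel A B := fun hlt' => asymm_of WellOrderingRel hlt hlt'
    simp only [inversionSign, h, h1, and_false, if_false, hlt, and_self, if_true, mul_one]

/-- The sign of the permutation that sorts the commuting pairs of a sequence of supports. -/
noncomputable def listSign : List S → ℤˣ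
  | [] => 1
  | A :: L => listSign L * (L.map fun B => W.inversionSign B A).prod

/-- The sign by which the product of a word differs from the basis element of its class. -/
noncomputable def wordSign (u : List I) : ℤˣ := W.listSign (D.supports u)

theorem wordSign_cons (a : I) (u : List I) : W.wordSign (a :: u) =
    W.wordSign u * ((D.supports u).map fun B => W.inversionSign B (D.state u • D.supp a)).prod :=
  rfl

/-- The sign contributed by a final letter depends only on the multiset of earlier supports and on
the state, both invariant under exchanges. -/
theorem wordSign_mul_cons {u v : List I} (h : D.Equiv u v) (a : I) :
    W.wordSign u * W.wordSign (a :: u) = W.wordSign v * W.wordSign (a :: v) := by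
  rw [wordSign_cons, wordSign_cons, ← mul_assoc, ← mul_assoc, Int.units_mul_self,
    Int.units_mul_self, one_mul, one_mul, h.state_eq]
  exact (h.supports_perm.map _).prod_eq

/-- An exchange alters the relative order of one pair of supports only, so only one factor of the
inversion sign changes. -/
theorem wordSign_swap {a b : I} (h : D.CommPair a b) (u : List I) :
    W.wordSign (b :: a :: u) =
      W.pairSign a b * W.wordSign (D.snd a b :: D.fst a b :: u) := by
  have hc : D.Comm (D.state u • D.supp a) (D.state u • (D.perm a • D.supp b)) :=
    D.comm_smul _ h
  rw [wordSign, wordSign, supports_cons_cons, supports_fst_snd h]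
  simp only [listSign, List.map_cons, List.prod_cons]
  rw [W.inversionSign_mul hc, W.sign_smul, ← pairSign]
  simp only [mul_assoc, mul_left_comm, mul_comm]

/-- Two adjacent letters of the word have product zero. -/
inductive HasNull : List I → Prop
  | head (u : List I) (a b : I) : W.NullPair a b → HasNull (b :: a :: u)
  | cons (a : I) {u : List I} : HasNull u → HasNull (a :: u)

/-- The word represents zero. -/
def IsNull (u : List I) : Prop := ∃ v, D.Equiv u v ∧ W.HasNull v

variable {W}

theorem IsNull.congr {u v : List I} (h : D.Equiv u v) (hu : W.IsNull u) : W.IsNull v := by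
  obtain ⟨w, hw, hn⟩ := hu
  exact ⟨w, h.symm.trans hw, hn⟩

theorem isNull_congr {u v : List I} (h : D.Equiv u v) : W.IsNull u ↔ W.IsNull v :=
  ⟨.congr h, .congr h.symm⟩

theorem IsNull.cons (a : I) {u : List I} (hu : W.IsNull u) : W.IsNull (a :: u) := by
  obtain ⟨w, hw, hn⟩ := hu
  exact ⟨a :: w, hw.cons a, hn.cons a⟩

theorem isNull_of_nullPair {a b : I} (h : W.NullPair a b) (u : List I) :
    W.IsNull (b :: a :: u) := ⟨_, .refl _, .head u a b h⟩

theorem not_isNull_nil : ¬ W.IsNull ([] : List I) := by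
  rintro ⟨v, h, hv⟩
  obtain rfl := List.length_eq_zero_iff.1 h.length_eq.symm
  cases hv

/-- Moves a vanishing pair across a letter: in `f c a`, with `a` exchangeable past `c` and vanishing
next to `f`, the axiom `comm_or_null` says that `f c` already vanishes or that `f` can be moved past
`c` until it is next to `a`. -/
theorem NullPair.of_exchange_fst {c a f : I} (h : D.CommPair c a) (hf : W.NullPair f (D.fst c a)) :
    W.NullPair f c ∨ (D.CommPair f c ∧ W.NullPair (D.snd f c) a) := by
  have h1 : D.Comm (D.perm f • D.supp c) (D.perm f • D.supp (D.fst c a)) := by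
    rw [D.comm_smul_iff, D.supp_fst h]
    exact h
  rcases W.comm_or_null hf h1 with h2 | h2
  · refine Or.inr ⟨h2, ?_⟩
    rw [NullPair, ← W.null_smul_iff (D.perm (D.fst f c)), D.smul_supp_snd h2, ← mul_smul,
      D.perm_mul h2, mul_smul, ← D.supp_fst h]
    exact hf
  · exact Or.inl h2

theorem NullPair.of_exchange_snd {c a g : I} (h : D.CommPair c a) (hg : D.CommPair g (D.fst c a))
    (hn : W.NullPair (D.snd g (D.fst c a)) (D.snd c a)) : W.NullPair g c := by
  rw [NullPair, ← W.null_smul_iff (D.perm (D.fst g (D.fst c a))), D.smul_supp_snd hg, ← mul_smul,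
    D.perm_mul hg, mul_smul, D.smul_supp_snd h] at hn
  exact hn

/-- Determines which words a final letter annihilates, and so the null part of the colon ideals. A
vanishing pair in an equivalent word is transported back by `Equiv.exchange`: it lands inside `u`,
or involves `a` and a possible last letter of `u`. The induction is on the length of `u`. -/
theorem isNull_cons_iff {a : I} {u : List I} :
    W.IsNull (a :: u) ↔ W.IsNull u ∨ ∃ c t, W.NullPair c a ∧ D.Equiv u (c :: t) := by
  constructor
  · induction hn : u.length using Nat.strong_induction_on generalizing a u with
    | h n ih =>
      rintro ⟨v, hv, hnull⟩
      cases hnull with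
      | head x f e hfe =>
        rcases hv.exchange with ⟨rfl, h⟩ | ⟨c, t, hc, rfl, h1, h2⟩
        · exact Or.inr ⟨f, x, hfe, h⟩
        · left
          rcases h2.exchange with ⟨rfl, h⟩ | ⟨g, r, hg, hf, h3, h4⟩
          · exact absurd hc.swap (W.not_commPair hfe)
          -- Undoing both exchanges puts the vanishing pair at the end of `u`, as `fst g f` followed
          -- by `c`.
          · have hgc' : D.CommPair (D.fst g f) (D.fst c a) := by rw [hf]; exact hg.swap
            have hnull : W.NullPair (D.fst g f) c :=
              NullPair.of_exchange_snd hc hgc' (by rw [hf, hg.snd_snd]; exact hfe)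
            exact (isNull_of_nullPair hnull r).congr ((h4.cons c).symm.trans h1.symm)
      | @cons e y hy =>
        rcases hv.exchange with ⟨rfl, h⟩ | ⟨c, t, hc, rfl, h1, h2⟩
        · exact Or.inl ⟨y, h, hy⟩
        · have hlt : t.length < n := by rw [← hn, h1.length_eq]; simp
          rcases ih _ hlt rfl ⟨y, h2.symm, hy⟩ with h | ⟨f, r, hf, h3⟩
          · exact Or.inl ((h.cons c).congr h1.symm)
          · rcases NullPair.of_exchange_fst hc hf with h4 | ⟨h4, h5⟩
            · exact Or.inl ((isNull_of_nullPair h4 r).congr ((h3.cons c).symm.trans h1.symm))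
            · exact Or.inr ⟨_, _, h5, h1.trans ((h3.cons c).trans (h4.equiv r))⟩
  · rintro (h | ⟨c, t, hc, h⟩)
    · exact h.cons a
    · exact (isNull_of_nullPair hc t).congr (h.symm.cons a)

theorem not_isNull_singleton (a : I) : ¬ W.IsNull [a] := by
  rw [isNull_cons_iff]
  rintro (h | ⟨c, t, -, h⟩)
  · exact not_isNull_nil h
  · exact absurd h.length_eq (by simp)

theorem isNull_pair_iff {a b : I} : W.IsNull [b, a] ↔ W.NullPair a b := by
  refine ⟨fun h => ?_, fun h => isNull_of_nullPair h []⟩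
  rcases isNull_cons_iff.1 h with h | ⟨c, t, hc, h⟩
  · exact absurd h (not_isNull_singleton a)
  · obtain ⟨rfl, -⟩ := List.cons_eq_cons.1 (equiv_singleton h)
    exact hc

end Twist

end Exchange


/-! ### Universal property of quadratic algebras -/

section QuadAlg

variable {I : Type} [Fintype I] {A B : Type} [Ring A] [Ring B]

theorem map_quadEval (f : A →+* B) (z : I → A) (c : I × I → ℤ) :
    f (quadEval z c) = quadEval (fun a => f (z a)) c := by
  simp only [quadEval, map_sum, map_zsmul, map_mul]

theorem quadEval_single (z : I → A) [DecidableEq I] (p : I × I) :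
    quadEval z (Pi.single p 1) = z p.1 * z p.2 := by
  rw [quadEval, Finset.sum_eq_single p]
  · simp
  · intro q _ hq
    simp [Pi.single_eq_of_ne hq]
  · simp

theorem quadEval_sub_smul (z : I → A) (c d : I × I → ℤ) (k : ℤ) :
    quadEval z (c - k • d) = quadEval z c - k • quadEval z d := by
  simp only [quadEval, Pi.sub_apply, Pi.smul_apply, sub_smul, Finset.sum_sub_distrib,
    Finset.smul_sum, smul_assoc]

theorem QuadAlg.quadEval_gen {R : Submodule ℤ (I × I → ℤ)} {r : I × I → ℤ} (hr : r ∈ R) :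
    quadEval (QuadAlg.gen R) r = 0 := by
  have h := RingQuot.mkRingHom_rel (QuadRel.mk (R := R) r hr)
  rw [map_quadEval, map_zero] at h
  exact h

theorem freeAlgebra_ringHom_ext {I : Type} {f g : FreeAlgebra ℤ I →+* B}
    (h : ∀ a, f (FreeAlgebra.ι ℤ a) = g (FreeAlgebra.ι ℤ a)) : f = g := by
  ext x
  induction x using FreeAlgebra.induction with
  | grade0 n => simp
  | grade1 a => exact h a
  | mul a b ha hb => rw [map_mul, map_mul, ha, hb]
  | add a b ha hb => rw [map_add, map_add, ha, hb]

/-- The ring homomorphism from a quadratic algebra given by elements satisfying its relations. -/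
noncomputable def QuadAlg.lift {R : Submodule ℤ (I × I → ℤ)} (x : I → B)
    (hx : ∀ r ∈ R, quadEval x r = 0) : QuadAlg R →+* B :=
  RingQuot.lift ⟨((FreeAlgebra.lift ℤ x : FreeAlgebra ℤ I →ₐ[ℤ] B) : FreeAlgebra ℤ I →+* B), by
    rintro _ _ ⟨r, hr⟩
    rw [map_quadEval, map_zero]
    simpa using hx r hr⟩

theorem QuadAlg.lift_gen {R : Submodule ℤ (I × I → ℤ)} (x : I → B)
    (hx : ∀ r ∈ R, quadEval x r = 0) (a : I) : QuadAlg.lift x hx (QuadAlg.gen R a) = x a := by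
  refine (RingQuot.lift_mkRingHom_apply _ _ _).trans ?_
  simp

theorem QuadAlg.ringHom_ext {R : Submodule ℤ (I × I → ℤ)} {f g : QuadAlg R →+* B}
    (h : ∀ a, f (QuadAlg.gen R a) = g (QuadAlg.gen R a)) : f = g :=
  RingQuot.ringQuot_ext _ _ (freeAlgebra_ringHom_ext h)

theorem iSupIndep_of_proj {ι : Type} (C : ι → Submodule ℤ A) (π : ι → A →+ A)
    (h1 : ∀ i, ∀ x ∈ C i, π i x = x) (h2 : ∀ i j, j ≠ i → ∀ x ∈ C j, π i x = 0) :
    iSupIndep C := by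
  intro i
  rw [Submodule.disjoint_def]
  intro x hx hx'
  have hle : (⨆ j, ⨆ (_ : j ≠ i), C j) ≤ LinearMap.ker (π i).toIntLinearMap :=
    iSup₂_le fun j hj y hy => h2 i j hj y hy
  rw [← h1 i x hx]
  exact hle hx'

/-- The product of a word, whose last letter comes first. -/
def wordProd (z : I → A) : List I → A
  | [] => 1
  | a :: u => wordProd z u * z a

omit [Fintype I] in
theorem wordProd_eq (z : I → A) (u : List I) : wordProd z u = (u.reverse.map z).prod := by
  induction u with
  | nil => rfl
  | cons a u ih => simp [wordProd, ih]

end QuadAlg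

/-! ### Exchange relations and the right module on classes of nonzero words -/

namespace Exchange

variable {I S G : Type} [Group G] [MulAction G S] {D : Exchange I S G}

/-- The exchange is a fixed-point-free involution on the exchangeable pairs, so the summands cancel
in pairs. -/
theorem sum_eq_zero_of_exchange [Fintype I] {M : Type} [AddCommGroup M] (F : I × I → M)
    (h0 : ∀ a b, ¬ D.CommPair a b → F (a, b) = 0)
    (h1 : ∀ a b, D.CommPair a b → F (a, b) + F (D.fst a b, D.snd a b) = 0) :
    ∑ p, F p = 0 := by
  classical
  refine Finset.sum_involution
    (fun p _ => if D.CommPair p.1 p.2 then (D.fst p.1 p.2, D.snd p.1 p.2) else p) ?_ ?_ ?_ ?_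
  · rintro ⟨a, b⟩ -
    by_cases h : D.CommPair a b
    · simp only [h, if_true]
      exact h1 a b h
    · simp [h, h0 a b h]
  · rintro ⟨a, b⟩ - hne
    by_cases h : D.CommPair a b
    · simp only [h, if_true]
      exact h.swap_ne
    · exact absurd (h0 a b h) hne
  · simp
  · rintro ⟨a, b⟩ -
    by_cases h : D.CommPair a b
    · simp only [h, if_true, h.swap, h.fst_fst, h.snd_snd]
    · simp [h]

namespace Twist

variable (W : D.Twist)

/-- The quadratic relations `z_a z_b = ± z_(fst a b) z_(snd a b)` for exchangeable pairs and
`z_a z_b = 0` for null pairs, described by conditions on the coefficients. -/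
def relations : Submodule ℤ (I × I → ℤ) where
  carrier := {c | (∀ a b, ¬ D.CommPair a b → ¬ W.NullPair a b → c (a, b) = 0) ∧
    ∀ a b, D.CommPair a b → (W.pairSign a b : ℤ) * c (a, b) + c (D.fst a b, D.snd a b) = 0}
  zero_mem' := by simp
  add_mem' := by
    rintro c d ⟨hc, hc'⟩ ⟨hd, hd'⟩
    refine ⟨fun a b h h' => by simp [hc a b h h', hd a b h h'], fun a b h => ?_⟩
    simp only [Pi.add_apply]
    linear_combination hc' a b h + hd' a b h
  smul_mem' := by
    rintro k c ⟨hc, hc'⟩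
    refine ⟨fun a b h h' => by simp [hc a b h h'], fun a b h => ?_⟩
    simp only [Pi.smul_apply, smul_eq_mul]
    linear_combination k * hc' a b h

theorem single_mem_relations [DecidableEq I] {a b : I} (h : W.NullPair a b) :
    Pi.single (a, b) 1 ∈ W.relations := by
  have hne : ∀ c d, ¬ W.NullPair c d → (Pi.single (a, b) 1 : I × I → ℤ) (c, d) = 0 := by
    intro c d h'
    apply Pi.single_eq_of_ne
    rintro he
    obtain ⟨rfl, rfl⟩ := Prod.mk.inj he
    exact h' h
  refine ⟨fun c d _ h' => hne c d h', fun c d h' => ?_⟩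
  rw [hne c d fun hn => W.not_commPair hn h', hne _ _ fun hn => W.not_commPair hn h'.swap]
  simp

theorem single_sub_mem_relations [DecidableEq I] {a b : I} (h : D.CommPair a b) :
    Pi.single (a, b) 1 - (W.pairSign a b : ℤ) • Pi.single (D.fst a b, D.snd a b) 1
      ∈ W.relations := by
  constructor
  · intro c d hc _
    have h1 : (c, d) ≠ (a, b) := by
      rintro he
      obtain ⟨rfl, rfl⟩ := Prod.mk.inj he
      exact hc h
    have h2 : (c, d) ≠ (D.fst a b, D.snd a b) := by
      rintro he
      obtain ⟨rfl, rfl⟩ := Prod.mk.inj he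
      exact hc h.swap
    simp [Pi.single_eq_of_ne h1, Pi.single_eq_of_ne h2]
  · intro c d hc
    have hs := Int.units_coe_mul_self (W.pairSign a b)
    by_cases h1 : (c, d) = (a, b)
    · obtain ⟨rfl, rfl⟩ := Prod.mk.inj h1
      simp [Pi.single_eq_of_ne h.swap_ne, Pi.single_eq_of_ne h.swap_ne.symm]
    · by_cases h2 : (c, d) = (D.fst a b, D.snd a b)
      · obtain ⟨rfl, rfl⟩ := Prod.mk.inj h2
        rw [W.pairSign_swap h, h.fst_fst, h.snd_snd]
        simp [Pi.single_eq_of_ne h.swap_ne, Pi.single_eq_of_ne h.swap_ne.symm, hs]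
      · have h3 : (D.fst c d, D.snd c d) ≠ (a, b) := by
          rintro he
          obtain ⟨rfl, rfl⟩ := Prod.mk.inj he
          rw [hc.fst_fst, hc.snd_snd] at h2
          exact h2 rfl
        have h4 : (D.fst c d, D.snd c d) ≠ (D.fst a b, D.snd a b) := by
          intro he
          obtain ⟨he1, he2⟩ := Prod.mk.inj he
          have h5 := hc.fst_fst
          have h6 := hc.snd_snd
          rw [he1, he2, h.fst_fst] at h5
          rw [he1, he2, h.snd_snd] at h6
          exact h1 (by rw [h5, h6])
        simp [Pi.single_eq_of_ne h1, Pi.single_eq_of_ne h2, Pi.single_eq_of_ne h3,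
          Pi.single_eq_of_ne h4]

variable {A : Type} [Ring A]

theorem quadEval_eq_zero [Fintype I] (z : I → A)
    (h1 : ∀ a b, D.CommPair a b →
      z a * z b = (W.pairSign a b : ℤ) • (z (D.fst a b) * z (D.snd a b)))
    (h2 : ∀ a b, W.NullPair a b → z a * z b = 0) {c : I × I → ℤ} (hc : c ∈ W.relations) :
    quadEval z c = 0 := by
  refine sum_eq_zero_of_exchange (D := D) _ ?_ ?_
  · intro a b h
    by_cases hn : W.NullPair a b
    · simp [h2 a b hn]
    · simp [hc.1 a b h hn]
  · intro a b h
    simp only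
    rw [h1 a b h, smul_smul, ← add_smul, mul_comm, hc.2 a b h, zero_smul]

/-- The ring `A` is presented by the generators `z` and the relations of `W`. -/
def Presents [Fintype I] (z : I → A) : Prop :=
  ∃ e : QuadAlg W.relations ≃+* A, ∀ a, e (QuadAlg.gen _ a) = z a

variable (D) in
/-- The equivalence relation of exchanges. -/
def wordSetoid : Setoid (List I) := Relation.EqvGen.setoid D.Step

/-- The class of words represents zero. -/
def IsNullClass : Quotient (wordSetoid D) → Prop :=
  Quotient.lift W.IsNull (by
    intro u v h
    exact propext (isNull_congr h))

/-- Classes of nonzero words. -/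
abbrev Class : Type :=
  {q : Quotient (wordSetoid D) // ¬ W.IsNullClass q}

variable {W}

/-- The class of a nonzero word. -/
def Class.mk (u : List I) (h : ¬ W.IsNull u) : W.Class := ⟨Quotient.mk _ u, h⟩

/-- A word representing a class. -/
noncomputable def Class.rep (m : W.Class) : List I := m.1.out

theorem Class.not_isNull_rep (m : W.Class) : ¬ W.IsNull m.rep := by
  obtain ⟨q, hq⟩ := m
  induction q using Quotient.inductionOn with
  | h u =>
    have h : D.Equiv (Quotient.mk (wordSetoid D) u).out u := Quotient.mk_out (s := wordSetoid D) u
    exact fun hn => hq (hn.congr h)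

theorem Class.mk_rep (m : W.Class) : Class.mk m.rep m.not_isNull_rep = m :=
  Subtype.ext (Quotient.out_eq _)

theorem Class.mk_eq_iff {u v : List I} {hu : ¬ W.IsNull u} {hv : ¬ W.IsNull v} :
    Class.mk u hu = Class.mk v hv ↔ D.Equiv u v :=
  Subtype.ext_iff.trans Quotient.eq

theorem Class.rep_mk (u : List I) (h : ¬ W.IsNull u) : D.Equiv (Class.mk u h).rep u :=
  Class.mk_eq_iff.1 (Class.mk_rep _)

variable (W) in
open Classical in
/-- The basis vector of a word, up to sign, or zero. -/
noncomputable def wordVec (u : List I) : W.Class →₀ ℤ :=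
  if h : W.IsNull u then 0 else Finsupp.single (Class.mk u h) (W.wordSign u : ℤ)

theorem wordVec_of_isNull {u : List I} (h : W.IsNull u) : W.wordVec u = 0 := dif_pos h

theorem wordVec_of_not {u : List I} (h : ¬ W.IsNull u) :
    W.wordVec u = Finsupp.single (Class.mk u h) (W.wordSign u : ℤ) := dif_neg h

theorem wordSign_smul_wordVec {u v : List I} (h : D.Equiv u v) :
    (W.wordSign u : ℤ) • W.wordVec u = (W.wordSign v : ℤ) • W.wordVec v := by
  by_cases hu : W.IsNull u
  · rw [wordVec_of_isNull hu, wordVec_of_isNull (hu.congr h), smul_zero, smul_zero]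
  · have hv := fun hv : W.IsNull v => hu ((isNull_congr h).2 hv)
    rw [wordVec_of_not hu, wordVec_of_not hv, show Class.mk u hu = Class.mk v hv from
      Class.mk_eq_iff.2 h]
    simp

variable (W) in
/-- Right multiplication by a letter. -/
noncomputable def mulRight (a : I) : (W.Class →₀ ℤ) →ₗ[ℤ] (W.Class →₀ ℤ) :=
  Finsupp.linearCombination ℤ fun m => (W.wordSign m.rep : ℤ) • W.wordVec (a :: m.rep)

theorem single_eq_wordVec (m : W.Class) :
    Finsupp.single m 1 = (W.wordSign m.rep : ℤ) • W.wordVec m.rep := by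
  rw [wordVec_of_not m.not_isNull_rep, m.mk_rep]
  simp

/-- The operator is defined on chosen representatives; the coherence `wordSign_mul_cons` makes the
formula valid for every word. -/
theorem mulRight_wordVec (a : I) (u : List I) :
    W.mulRight a (W.wordVec u) = W.wordVec (a :: u) := by
  by_cases hu : W.IsNull u
  · rw [wordVec_of_isNull hu, wordVec_of_isNull (hu.cons a), map_zero]
  · have h := Class.rep_mk u hu
    rw [wordVec_of_not hu, mulRight, Finsupp.linearCombination_single, smul_smul]
    set v := (Class.mk u hu).rep
    have h1 := wordSign_smul_wordVec (W := W) (h.cons a)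
    have h2 := congrArg (fun s : ℤˣ => (s : ℤ)) (W.wordSign_mul_cons h a)
    have h3 : W.wordVec (a :: v) =
        ((W.wordSign (a :: v) : ℤ) * (W.wordSign (a :: u) : ℤ)) • W.wordVec (a :: u) := by
      rw [mul_smul, ← h1, smul_smul, Int.units_coe_mul_self, one_smul]
    rw [h3, smul_smul]
    push_cast at h2
    rw [show (W.wordSign u : ℤ) * (W.wordSign v : ℤ) *
      ((W.wordSign (a :: v) : ℤ) * (W.wordSign (a :: u) : ℤ)) =
      (W.wordSign u : ℤ) * (W.wordSign (a :: u) : ℤ) *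
        ((W.wordSign v : ℤ) * (W.wordSign (a :: v) : ℤ)) by ring, h2,
      show (W.wordSign u : ℤ) * (W.wordSign (a :: u) : ℤ) *
        ((W.wordSign u : ℤ) * (W.wordSign (a :: u) : ℤ)) =
        ((W.wordSign u : ℤ) * (W.wordSign u : ℤ)) *
        ((W.wordSign (a :: u) : ℤ) * (W.wordSign (a :: u) : ℤ)) by ring,
      Int.units_coe_mul_self, Int.units_coe_mul_self, one_mul, one_smul]

theorem wordVec_linearMap_ext {M : Type} [AddCommGroup M] {f g : (W.Class →₀ ℤ) →ₗ[ℤ] M}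
    (h : ∀ u, f (W.wordVec u) = g (W.wordVec u)) : f = g := by
  refine Finsupp.lhom_ext' fun m => LinearMap.ext_ring ?_
  simp only [LinearMap.comp_apply, Finsupp.lsingle_apply]
  rw [single_eq_wordVec, map_smul, map_smul, h]

/-- The coefficients of a right multiple. -/
theorem mulRight_apply (a : I) (f : W.Class →₀ ℤ) {u : List I} (hu : ¬ W.IsNull u)
    (hau : ¬ W.IsNull (a :: u)) :
    W.mulRight a f (Class.mk (a :: u) hau) =
      (W.wordSign (a :: u) : ℤ) * (W.wordSign u : ℤ) * f (Class.mk u hu) := by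
  have h : (Finsupp.lapply (Class.mk (a :: u) hau)).comp (W.mulRight a) =
      ((W.wordSign (a :: u) : ℤ) * (W.wordSign u : ℤ)) •
        (Finsupp.lapply (R := ℤ) (M := ℤ) (Class.mk u hu)) := by
    refine wordVec_linearMap_ext fun v => ?_
    simp only [LinearMap.comp_apply, Finsupp.lapply_apply, LinearMap.smul_apply, smul_eq_mul,
      mulRight_wordVec]
    by_cases hv : W.IsNull v
    · simp [wordVec_of_isNull hv, wordVec_of_isNull (hv.cons a)]
    by_cases hvu : D.Equiv v u
    · have hav : ¬ W.IsNull (a :: v) := fun h => hau (h.congr (hvu.cons a))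
      have h2 := congrArg (fun s : ℤˣ => (s : ℤ)) (W.wordSign_mul_cons hvu a)
      push_cast at h2
      rw [wordVec_of_not hv, wordVec_of_not hav,
        show Class.mk v hv = Class.mk u hu from Class.mk_eq_iff.2 hvu,
        show Class.mk (a :: v) hav = Class.mk (a :: u) hau from Class.mk_eq_iff.2 (hvu.cons a),
        Finsupp.single_eq_same, Finsupp.single_eq_same,
        mul_comm (W.wordSign (a :: u) : ℤ), ← h2, mul_right_comm, Int.units_coe_mul_self, one_mul]
    · rw [wordVec_of_not hv, Finsupp.single_eq_of_ne, mul_zero]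
      · by_cases hav : W.IsNull (a :: v)
        · simp [wordVec_of_isNull hav]
        · rw [wordVec_of_not hav, Finsupp.single_eq_of_ne]
          -- Right cancellation: appending `a` cannot identify different classes.
          exact fun he => hvu (Class.mk_eq_iff.1 he).symm.of_cons
      · exact fun he => hvu (Class.mk_eq_iff.1 he).symm
  exact LinearMap.congr_fun h f

end Twist

end Exchange


/-! ### Basis, colon ideals and Koszulness of the presented algebras -/

namespace Exchange

variable {I S G : Type} [Group G] [MulAction G S] {D : Exchange I S G}

namespace Twist

variable {W : D.Twist} [Fintype I]

namespace Presents

variable {A : Type} [Ring A] {z : I → A}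

theorem quadEval_eq_zero (hz : W.Presents z) {r : I × I → ℤ} (hr : r ∈ W.relations) :
    quadEval z r = 0 := by
  obtain ⟨e, he⟩ := hz
  have h := congrArg (e : QuadAlg W.relations →+* A) (QuadAlg.quadEval_gen hr)
  rw [map_quadEval, map_zero] at h
  simpa [he] using h

theorem mul_eq (hz : W.Presents z) {a b : I} (h : D.CommPair a b) :
    z a * z b = (W.pairSign a b : ℤ) • (z (D.fst a b) * z (D.snd a b)) := by
  classical
  have h1 := hz.quadEval_eq_zero (W.single_sub_mem_relations h)
  rwa [quadEval_sub_smul, quadEval_single, quadEval_single, sub_eq_zero] at h1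

theorem mul_eq_zero (hz : W.Presents z) {a b : I} (h : W.NullPair a b) : z a * z b = 0 := by
  classical
  have h1 := hz.quadEval_eq_zero (W.single_mem_relations h)
  rwa [quadEval_single] at h1

theorem wordProd_step (hz : W.Presents z) {u v : List I} (h : D.Step u v) :
    (W.wordSign u : ℤ) • wordProd z u = (W.wordSign v : ℤ) • wordProd z v := by
  induction h with
  | swap u a b h =>
    rw [W.wordSign_swap h]
    simp only [wordProd, mul_assoc, hz.mul_eq h, mul_smul_comm, smul_smul]
    push_cast
    rw [mul_right_comm, Int.units_coe_mul_self, one_mul]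
  | @cons a u v h ih =>
    have h1 := congrArg (fun s : ℤˣ => (s : ℤ)) (W.wordSign_mul_cons (.rel _ _ h) a)
    push_cast at h1
    have h2 : ∀ w : List I, (W.wordSign (a :: w) : ℤ) • wordProd z (a :: w) =
        ((W.wordSign w : ℤ) * (W.wordSign (a :: w) : ℤ)) •
          (((W.wordSign w : ℤ) • wordProd z w) * z a) := by
      intro w
      rw [smul_mul_assoc, smul_smul, mul_right_comm, Int.units_coe_mul_self, one_mul, wordProd]
    rw [h2, h2, h1, ih]

theorem wordProd_equiv (hz : W.Presents z) {u v : List I} (h : D.Equiv u v) :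
    (W.wordSign u : ℤ) • wordProd z u = (W.wordSign v : ℤ) • wordProd z v :=
  h.lift (f := fun u => (W.wordSign u : ℤ) • wordProd z u) fun _ _ => hz.wordProd_step

theorem smul_wordProd_equiv (hz : W.Presents z) {u v : List I} (h : D.Equiv u v) :
    wordProd z u = ((W.wordSign u : ℤ) * (W.wordSign v : ℤ)) • wordProd z v := by
  rw [mul_smul, ← hz.wordProd_equiv h, smul_smul, Int.units_coe_mul_self, one_smul]

theorem wordProd_eq_zero (hz : W.Presents z) {u : List I} (h : W.IsNull u) :
    wordProd z u = 0 := by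
  obtain ⟨v, h, hv⟩ := h
  rw [hz.smul_wordProd_equiv h]
  suffices wordProd z v = 0 by rw [this, smul_zero]
  clear h
  induction hv with
  | head u a b h => rw [wordProd, wordProd, mul_assoc, hz.mul_eq_zero h, mul_zero]
  | cons a _ ih => rw [wordProd, ih, zero_mul]

theorem span_wordProd (hz : W.Presents z) :
    Submodule.span ℤ (Set.range (wordProd z)) = ⊤ := by
  obtain ⟨e, he⟩ := hz
  let f : FreeAlgebra ℤ I →+* A := (e : QuadAlg W.relations →+* A).comp (RingQuot.mkRingHom _)
  have hf : Function.Surjective f := e.surjective.comp (RingQuot.mkRingHom_surjective _)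
  have key : ∀ x : FreeAlgebra ℤ I, ∀ y ∈ Submodule.span ℤ (Set.range (wordProd z)),
      y * f x ∈ Submodule.span ℤ (Set.range (wordProd z)) := by
    intro x
    induction x using FreeAlgebra.induction with
    | grade0 n =>
      intro y hy
      rw [show f (algebraMap ℤ (FreeAlgebra ℤ I) n) = (n : A) by simp, ← zsmul_eq_mul']
      exact Submodule.smul_mem _ _ hy
    | grade1 a =>
      intro y hy
      rw [show f (FreeAlgebra.ι ℤ a) = z a from he a]
      induction hy using Submodule.span_induction with
      | mem y hy =>
        obtain ⟨u, rfl⟩ := hy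
        exact Submodule.subset_span ⟨a :: u, rfl⟩
      | zero => simp
      | add y y' _ _ h h' => rw [add_mul]; exact add_mem h h'
      | smul k y _ h => rw [smul_mul_assoc]; exact Submodule.smul_mem _ _ h
    | mul a b ha hb =>
      intro y hy
      rw [map_mul, ← mul_assoc]
      exact hb _ (ha y hy)
    | add a b ha hb =>
      intro y hy
      rw [map_add, mul_add]
      exact add_mem (ha y hy) (hb y hy)
  rw [eq_top_iff]
  intro x _
  obtain ⟨x, rfl⟩ := hf x
  rw [← one_mul (f x)]
  exact key x 1 (Submodule.subset_span ⟨[], rfl⟩)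

@[elab_as_elim]
theorem induction (hz : W.Presents z) {p : A → Prop} (word : ∀ u, p (wordProd z u))
    (zero : p 0) (add : ∀ x y, p x → p y → p (x + y)) (smul : ∀ (k : ℤ) x, p x → p (k • x))
    (x : A) : p x := by
  have hx : x ∈ Submodule.span ℤ (Set.range (wordProd z)) := by
    rw [hz.span_wordProd]
    trivial
  induction hx using Submodule.span_induction with
  | mem x hx =>
    obtain ⟨u, rfl⟩ := hx
    exact word u
  | zero => exact zero
  | add x y _ _ hx hy => exact add x y hx hy
  | smul k x _ hx => exact smul k x hx

/-- Elements satisfying the relations define a ring homomorphism. -/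
theorem exists_lift (hz : W.Presents z) {B : Type} [Ring B] (x : I → B)
    (hx : ∀ r ∈ W.relations, quadEval x r = 0) : ∃ f : A →+* B, ∀ a, f (z a) = x a := by
  obtain ⟨e, he⟩ := hz
  refine ⟨(QuadAlg.lift x hx).comp (e.symm : A →+* QuadAlg W.relations), fun a => ?_⟩
  simp [← he a, QuadAlg.lift_gen]

/-- The opposite of the endomorphism ring appears because letters act by right multiplication. The
relations hold since an exchange changes `wordVec` by the prescribed sign and a null pair kills it.
-/
theorem exists_action (hz : W.Presents z) :
    ∃ f : A →+* (Module.End ℤ (W.Class →₀ ℤ))ᵐᵒᵖ, ∀ a, f (z a) = .op (W.mulRight a) := by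
  refine hz.exists_lift _ fun r hr => W.quadEval_eq_zero _ ?_ ?_ hr
  · intro a b h
    rw [← MulOpposite.op_mul, ← MulOpposite.op_mul, ← MulOpposite.op_smul]
    congr 1
    refine wordVec_linearMap_ext fun u => ?_
    simp only [Module.End.mul_apply, LinearMap.smul_apply, mulRight_wordVec]
    have h1 := wordSign_smul_wordVec (W := W) (h.equiv u)
    have h2 : W.wordVec (b :: a :: u) = ((W.wordSign (b :: a :: u) : ℤ) *
        (W.wordSign (D.snd a b :: D.fst a b :: u) : ℤ)) •
          W.wordVec (D.snd a b :: D.fst a b :: u) := by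
      rw [mul_smul, ← h1, smul_smul, Int.units_coe_mul_self, one_smul]
    rw [h2, W.wordSign_swap h]
    push_cast
    rw [mul_assoc, Int.units_coe_mul_self, mul_one]
  · intro a b h
    rw [← MulOpposite.op_mul, ← MulOpposite.op_zero]
    congr 1
    refine wordVec_linearMap_ext fun u => ?_
    simp only [Module.End.mul_apply, mulRight_wordVec, LinearMap.zero_apply]
    exact wordVec_of_isNull (isNull_of_nullPair h u)

/-- The classes of nonzero words form a basis. -/
theorem exists_coords (hz : W.Presents z) :
    ∃ φ : A ≃ₗ[ℤ] (W.Class →₀ ℤ), (∀ u, φ (wordProd z u) = W.wordVec u) ∧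
      ∀ x a, φ (x * z a) = W.mulRight a (φ x) := by
  obtain ⟨f, hf⟩ := hz.exists_action
  -- Coordinates are obtained by acting on the class of the empty word; the inverse sends a class to
  -- the signed product of a representative.
  let φ : A →ₗ[ℤ] (W.Class →₀ ℤ) := AddMonoidHom.toIntLinearMap
    { toFun := fun x => (f x).unop (W.wordVec [])
      map_zero' := by simp
      map_add' := by simp }
  have hφ : ∀ x, φ x = (f x).unop (W.wordVec []) := fun x => rfl
  have hmul : ∀ x a, φ (x * z a) = W.mulRight a (φ x) := by
    intro x a
    rw [hφ, hφ, map_mul, hf, MulOpposite.unop_mul, MulOpposite.unop_op, Module.End.mul_apply]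
  have hword : ∀ u, φ (wordProd z u) = W.wordVec u := by
    intro u
    induction u with
    | nil => rw [hφ, wordProd, map_one, MulOpposite.unop_one, Module.End.one_apply]
    | cons a u ih => rw [wordProd, hmul, ih, mulRight_wordVec]
  let ψ : (W.Class →₀ ℤ) →ₗ[ℤ] A :=
    Finsupp.linearCombination ℤ fun m => (W.wordSign m.rep : ℤ) • wordProd z m.rep
  have hψ : ∀ u, ψ (W.wordVec u) = wordProd z u := by
    intro u
    by_cases hu : W.IsNull u
    · rw [wordVec_of_isNull hu, map_zero, hz.wordProd_eq_zero hu]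
    · rw [wordVec_of_not hu, Finsupp.linearCombination_single,
        hz.wordProd_equiv (Class.rep_mk u hu), smul_smul, Int.units_coe_mul_self, one_smul]
  refine ⟨LinearEquiv.ofLinearMap φ ψ ?_ ?_, hword, hmul⟩
  · refine wordVec_linearMap_ext fun u => ?_
    rw [LinearMap.comp_apply, hψ, hword, LinearMap.id_apply]
  · ext x
    rw [LinearMap.comp_apply, LinearMap.id_apply]
    induction x using hz.induction with
    | word u => rw [hword, hψ]
    | zero => simp
    | add x y hx hy => rw [map_add, map_add, hx, hy]
    | smul k x hx => rw [map_smul, map_smul, hx]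

theorem free (hz : W.Presents z) : Module.Free ℤ A := by
  obtain ⟨φ, -⟩ := hz.exists_coords
  exact Module.Free.of_equiv φ.symm

/-- In the basis, words of length two coincide up to sign exactly when they are equal or exchanged.
Reading off coefficients therefore shows that there are no further quadratic relations. -/
theorem quadRelations_eq (hz : W.Presents z) : quadRelations z = W.relations := by
  classical
  refine le_antisymm (fun c hc => ?_) fun c hc => hz.quadEval_eq_zero hc
  have hc' : quadEval z c = 0 := hc
  obtain ⟨φ, hφ, -⟩ := hz.exists_coords
  have hw : ∀ a b, φ (z a * z b) = W.wordVec [b, a] := by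
    intro a b
    rw [← hφ]
    simp [wordProd]
  have h0 : ∀ m, ∑ p : I × I, c p * W.wordVec [p.2, p.1] m = 0 := by
    intro m
    have h1 := congrArg φ hc'
    simp only [quadEval, map_sum, map_zero, map_zsmul, hw] at h1
    simpa [Finsupp.finsetSum_apply] using DFunLike.congr_fun h1 m
  have hne : ∀ a b (h : ¬ W.IsNull [b, a]) (p : I × I), p ≠ (a, b) →
      ¬ (D.CommPair a b ∧ p = (D.fst a b, D.snd a b)) →
      W.wordVec [p.2, p.1] (Class.mk [b, a] h) = 0 := by
    rintro a b h ⟨c, d⟩ h1 h2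
    by_cases hn : W.IsNull [d, c]
    · rw [wordVec_of_isNull hn, Finsupp.zero_apply]
    · rw [wordVec_of_not hn, Finsupp.single_eq_of_ne]
      intro he
      rcases equiv_pair (Class.mk_eq_iff.1 he) with ⟨rfl, rfl⟩ | ⟨h3, rfl, rfl⟩
      · exact h1 rfl
      · exact h2 ⟨h3, rfl⟩
  have hself : ∀ a b (h : ¬ W.IsNull [b, a]),
      W.wordVec [b, a] (Class.mk [b, a] h) = (W.wordSign [b, a] : ℤ) := by
    intro a b h
    rw [wordVec_of_not h, Finsupp.single_eq_same]
  refine ⟨fun a b h h' => ?_, fun a b h => ?_⟩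
  · have hn : ¬ W.IsNull [b, a] := fun hn => h' (isNull_pair_iff.1 hn)
    have h1 := h0 (Class.mk [b, a] hn)
    rw [Finset.sum_eq_single (a, b) (fun p _ hp => by
      rw [hne a b hn p hp fun h2 => h h2.1, mul_zero]) (by simp), hself] at h1
    exact (_root_.mul_eq_zero.1 h1).resolve_right (Units.ne_zero _)
  · have hn : ¬ W.IsNull [b, a] := fun hn => W.not_commPair (isNull_pair_iff.1 hn) h
    have hn' : ¬ W.IsNull [D.snd a b, D.fst a b] := fun hn' => hn (hn'.congr (h.equiv []).symm)
    have h1 := h0 (Class.mk [b, a] hn)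
    rw [Finset.sum_eq_add (a, b) (D.fst a b, D.snd a b) h.swap_ne.symm (fun p _ hp => by
      rw [hne a b hn p hp.1 fun h2 => hp.2 h2.2, mul_zero]) (by simp) (by simp), hself,
      show Class.mk [b, a] hn = Class.mk _ hn' from Class.mk_eq_iff.2 (h.equiv []), hself,
      W.wordSign_swap h] at h1
    push_cast at h1
    rw [← mul_assoc, ← add_mul, mul_comm (c (a, b))] at h1
    exact (_root_.mul_eq_zero.1 h1).resolve_right (Units.ne_zero _)

theorem isQuadratic (hz : W.Presents z) : IsQuadratic z := by
  rw [IsQuadratic, hz.quadRelations_eq]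
  exact hz

omit [Fintype I] in
theorem _root_.KoszulNil.Exchange.Twist.exists_of_mem_support_mulRight {b : I} {f : W.Class →₀ ℤ}
    {m : W.Class} (hm : m ∈ (W.mulRight b f).support) : ∃ t, D.Equiv m.rep (b :: t) := by
  rw [Finsupp.mem_support_iff, mulRight, Finsupp.linearCombination_apply, Finsupp.sum,
    Finsupp.finsetSum_apply] at hm
  obtain ⟨m', -, hm'⟩ := Finset.exists_ne_zero_of_sum_ne_zero hm
  refine ⟨m'.rep, ?_⟩
  by_cases hn : W.IsNull (b :: m'.rep)
  · simp [wordVec_of_isNull hn] at hm'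
  · rw [wordVec_of_not hn] at hm'
    by_cases he : Class.mk _ hn = m
    · rw [← he]
      exact Class.rep_mk _ hn
    · simp [Finsupp.single_eq_of_ne (Ne.symm he)] at hm'

/-- These left ideals are monomial: right multiplication by `z b` sends classes to signed classes of
words ending in `b`, or to zero. -/
theorem mem_span_iff (hz : W.Presents z) {φ : A ≃ₗ[ℤ] (W.Class →₀ ℤ)}
    (hφ : ∀ u, φ (wordProd z u) = W.wordVec u)
    (hφ' : ∀ x a, φ (x * z a) = W.mulRight a (φ x)) (T : Set I) (x : A) :
    x ∈ Submodule.span A (z '' T) ↔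
      ∀ m ∈ (φ x).support, ∃ b ∈ T, ∃ t, D.Equiv m.rep (b :: t) := by
  classical
  constructor
  · intro hx m hm
    obtain ⟨l, hl, rfl⟩ := (Finsupp.mem_span_image_iff_linearCombination A).1 hx
    simp only [Finsupp.linearCombination_apply, Finsupp.sum, map_sum, smul_eq_mul, hφ'] at hm
    obtain ⟨b, hb, hm⟩ := Finset.mem_biUnion.1 (Finsupp.support_finsetSum hm)
    exact ⟨b, (Finsupp.mem_supported A l).1 hl hb, exists_of_mem_support_mulRight hm⟩
  · intro h
    have hx : x = ∑ m ∈ (φ x).support, (φ x m * (W.wordSign m.rep : ℤ)) • wordProd z m.rep := by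
      apply φ.injective
      rw [map_sum]
      conv_lhs => rw [← Finsupp.sum_single (φ x), Finsupp.sum]
      refine Finset.sum_congr rfl fun m _ => ?_
      rw [map_smul, hφ, mul_smul, ← single_eq_wordVec, Finsupp.smul_single_one]
    rw [hx]
    refine sum_mem fun m hm => zsmul_mem ?_ _
    obtain ⟨b, hb, t, ht⟩ := h m hm
    rw [hz.smul_wordProd_equiv ht, wordProd]
    exact zsmul_mem (Submodule.smul_mem _ _ (Submodule.subset_span (Set.mem_image_of_mem z hb))) _

theorem hasColons (hz : W.Presents z) : HasColons z := by
  intro T a ha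
  obtain ⟨φ, hφ, hφ'⟩ := hz.exists_coords
  refine ⟨{c | W.NullPair c a ∨ (D.CommPair c a ∧ D.snd c a ∈ T)}, fun w => ⟨fun h => ?_, ?_⟩⟩
  · rw [hz.mem_span_iff hφ hφ'] at h ⊢
    intro m hm
    by_cases hn : W.IsNull (a :: m.rep)
    · rcases isNull_cons_iff.1 hn with hn | ⟨c, t, hc, ht⟩
      · exact absurd hn m.not_isNull_rep
      · exact ⟨c, Or.inl hc, t, ht⟩
    · have h1 : Class.mk (a :: m.rep) hn ∈ (φ (w * z a)).support := by
        -- No cancellation occurs: right cancellation makes this coefficient a sign times that of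
        -- `m`.
        rw [Finsupp.mem_support_iff, hφ', mulRight_apply a _ m.not_isNull_rep hn, m.mk_rep]
        exact _root_.mul_ne_zero (_root_.mul_ne_zero (Units.ne_zero _) (Units.ne_zero _))
          (Finsupp.mem_support_iff.1 hm)
      obtain ⟨b, hb, t, ht⟩ := h _ h1
      rcases ((Class.rep_mk _ hn).symm.trans ht).exchange with ⟨rfl, -⟩ | ⟨c, s, hc, rfl, h2, -⟩
      · exact absurd hb ha
      · exact ⟨c, Or.inr ⟨hc, hb⟩, s, h2⟩
  · intro hw
    induction hw using Submodule.span_induction with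
    | mem x hx =>
      obtain ⟨c, hc | ⟨hc, hb⟩, rfl⟩ := hx
      · rw [hz.mul_eq_zero hc]
        exact zero_mem _
      · rw [hz.mul_eq hc]
        exact zsmul_mem (Submodule.smul_mem _ _ (Submodule.subset_span (Set.mem_image_of_mem z hb))) _
    | zero => simp
    | add x y _ _ h h' => rw [add_mul]; exact add_mem h h'
    | smul k y _ h => rw [smul_eq_mul, mul_assoc]; exact Submodule.smul_mem _ _ h

theorem exists_augmentation (hz : W.Presents z) :
    ∃ ε : A →+* ℤ, (∀ a, ε (z a) = 0) ∧ ∀ x, ε x = 0 → x ∈ Submodule.span A (Set.range z) := by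
  obtain ⟨ε, hε⟩ := hz.exists_lift (fun _ => (0 : ℤ)) (fun r _ => by simp [quadEval])
  refine ⟨ε, hε, fun x hx => ?_⟩
  have key : x - (ε x : A) ∈ Submodule.span A (Set.range z) := by
    clear hx
    induction x using hz.induction with
    | word u =>
      cases u with
      | nil => simp [wordProd]
      | cons a u =>
        rw [wordProd, map_mul, hε, mul_zero, Int.cast_zero, sub_zero]
        exact Submodule.smul_mem _ _ (Submodule.subset_span ⟨a, rfl⟩)
    | zero => simp
    | add x y hx hy =>
      rw [map_add, Int.cast_add, add_sub_add_comm]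
      exact add_mem hx hy
    | smul k x hx =>
      rw [map_zsmul, smul_eq_mul, Int.cast_mul, ← zsmul_eq_mul, ← smul_sub]
      exact zsmul_mem hx k
  simpa [hx] using key

section Graded

variable {deg : I → ℤ}

/-- Length and total degree are constant on exchange classes, so restriction of the coordinates to
the classes with given invariants is a projection. -/
theorem exists_proj (hz : W.Presents z)
    (hdeg : ∀ a b, D.CommPair a b → deg (D.fst a b) + deg (D.snd a b) = deg a + deg b) :
    ∃ π : ℕ × ℤ → A →+ A, ∀ i u, π i (wordProd z u) =
      if (u.length, (u.map deg).sum) = i then wordProd z u else 0 := by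
  classical
  have hsum : ∀ u v, D.Equiv u v → (u.map deg).sum = (v.map deg).sum := by
    intro u v h
    refine h.lift (f := fun u => (u.map deg).sum) fun u v h => ?_
    induction h with
    | swap u a b h =>
      simp only [List.map_cons, List.sum_cons]
      linarith [hdeg a b h]
    | cons a _ ih => simpa using ih
  obtain ⟨φ, hφ, -⟩ := hz.exists_coords
  refine ⟨fun i => (φ.symm : (W.Class →₀ ℤ) →+ A).comp ((Finsupp.filterAddHom
    fun m : W.Class => (m.rep.length, (m.rep.map deg).sum) = i).comp (φ : A →+ (W.Class →₀ ℤ))),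
    fun i u => ?_⟩
  change φ.symm (Finsupp.filter _ (φ (wordProd z u))) = _
  rw [LinearEquiv.symm_apply_eq, apply_ite φ, map_zero, hφ]
  by_cases hu : W.IsNull u
  · rw [wordVec_of_isNull hu, ite_self]
    exact Finsupp.filter_zero _
  · have h1 := (Class.rep_mk u hu).length_eq
    have h2 := hsum _ _ (Class.rep_mk u hu)
    rw [wordVec_of_not hu]
    split_ifs with h
    · exact Finsupp.filter_single_of_pos _ (by rw [h1, h2]; exact h)
    · exact Finsupp.filter_single_of_neg _ (by rw [h1, h2]; exact h)

theorem exists_homogeneousProj (hz : W.Presents z)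
    (hdeg : ∀ a b, D.CommPair a b → deg (D.fst a b) + deg (D.snd a b) = deg a + deg b) :
    Nonempty (HomogeneousProj z deg) := by
  obtain ⟨π, hπ⟩ := hz.exists_proj hdeg
  refine ⟨⟨fun k e => π (k, e), ?_, ?_, ?_⟩⟩
  · intro k e a x
    induction x using hz.induction with
    | word u =>
      rw [← wordProd, hπ, hπ, ite_mul, zero_mul, wordProd]
      refine if_congr ?_ rfl rfl
      simp only [List.length_cons, List.map_cons, List.sum_cons, Prod.mk.injEq]
      omega
    | zero => simp
    | add x y hx hy => rw [add_mul, map_add, map_add, hx, hy, add_mul]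
    | smul m x hx => rw [smul_mul_assoc, map_zsmul, map_zsmul, hx, smul_mul_assoc]
  · intro e x
    induction x using hz.induction with
    | word u =>
      rw [hπ]
      split_ifs with h
      · obtain ⟨a, rfl⟩ := List.length_eq_one_iff.1 (Prod.mk.inj h).1
        exact Submodule.subset_span ⟨a, by simpa using h, by simp [wordProd]⟩
      · exact zero_mem _
    | zero => simp
    | add x y hx hy => rw [map_add]; exact add_mem hx hy
    | smul m x hx => rw [map_zsmul]; exact Submodule.smul_mem _ _ hx
  · intro a
    simpa [wordProd] using hπ (1, deg a) [a]

theorem isInternal (hz : W.Presents z)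
    (hdeg : ∀ a b, D.CommPair a b → deg (D.fst a b) + deg (D.snd a b) = deg a + deg b) :
    DirectSum.IsInternal (component z deg) := by
  obtain ⟨π, hπ⟩ := hz.exists_proj hdeg
  rw [DirectSum.isInternal_submodule_iff_iSupIndep_and_iSup_eq_top]
  have hmem : ∀ i j x, x ∈ component z deg j → π i x = if j = i then x else 0 := by
    intro i j x hx
    induction hx using Submodule.span_induction with
    | mem x hx =>
      obtain ⟨l, h1, h2, rfl⟩ := hx
      have h := hπ i l.reverse
      rw [wordProd_eq, List.reverse_reverse, List.length_reverse, List.map_reverse,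
        List.sum_reverse, h1, h2] at h
      exact h
    | zero => simp
    | add x y _ _ hx hy =>
      rw [map_add, hx, hy]
      split_ifs <;> simp
    | smul m x _ hx =>
      rw [map_zsmul, hx]
      split_ifs <;> simp
  constructor
  · exact iSupIndep_of_proj _ π (fun i x hx => by rw [hmem i i x hx, if_pos rfl])
      fun i j hij x hx => by rw [hmem i j x hx, if_neg hij]
  · rw [eq_top_iff, ← hz.span_wordProd, Submodule.span_le]
    rintro _ ⟨u, rfl⟩
    refine Submodule.mem_iSup_of_mem (u.length, (u.map deg).sum) (Submodule.subset_span
      ⟨u.reverse, by simp, by simp [List.sum_reverse], wordProd_eq z u⟩)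

theorem isKoszul (hz : W.Presents z)
    (hdeg : ∀ a b, D.CommPair a b → deg (D.fst a b) + deg (D.snd a b) = deg a + deg b) :
    IsKoszul z deg where
  graded := hz.isInternal hdeg
  free := hz.free
  quadratic := hz.isQuadratic
  resolution := by
    obtain ⟨π⟩ := hz.exists_homogeneousProj hdeg
    obtain ⟨ε, hε, hker⟩ := hz.exists_augmentation
    exact hasLinearResolution_of_hasColons z deg hz.hasColons π ε hε hker

end Graded

end Presents

/-! ### Quadratic duality -/

/-- The relations of `W'` are the perpendicular space of those of `W`, when the null pairs of `W'`
are the remaining pairs and the signs fit. -/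
theorem perp_relations {W' : D.Twist} (deg : I → ℤ)
    (hnull : ∀ a b, W'.NullPair a b ↔ ¬ D.CommPair a b ∧ ¬ W.NullPair a b)
    (hsign : ∀ a b, D.CommPair a b →
      koszulSign (deg (D.fst a b)) (deg (D.snd a b)) * W.pairSign a b =
        - (koszulSign (deg a) (deg b) * W'.pairSign a b))
    (hunit : ∀ a b, IsUnit (koszulSign (deg a) (deg b))) :
    perp deg W.relations = W'.relations := by
  classical
  refine le_antisymm (fun f hf => And.intro (fun a b h h' => ?_) fun a b h => ?_)
    fun f hf r hr => ?_
  · have hn : W.NullPair a b := by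
      by_contra hn
      exact h' ((hnull a b).2 ⟨h, hn⟩)
    have h1 := hf _ (W.single_mem_relations hn)
    rw [Finset.sum_eq_single (a, b) (fun p _ hp => by simp [Pi.single_eq_of_ne hp]) (by simp)] at h1
    simpa [(hunit a b).ne_zero] using h1
  -- Pairing with one exchange relation gives a linear equation between two coefficients of `f`;
  -- `hsign` turns it into the exchange relation for `W'`.
  · have h1 := hf _ (W.single_sub_mem_relations h)
    rw [Finset.sum_eq_add (a, b) (D.fst a b, D.snd a b) h.swap_ne.symm (fun p _ hp => by
      simp [Pi.single_eq_of_ne hp.1, Pi.single_eq_of_ne hp.2]) (by simp) (by simp)] at h1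
    simp only [Pi.sub_apply, Pi.smul_apply, Pi.single_eq_same, Pi.single_eq_of_ne h.swap_ne,
      Pi.single_eq_of_ne h.swap_ne.symm, smul_eq_mul] at h1
    have h2 := hsign a b h
    have h3 := Int.units_coe_mul_self (W'.pairSign a b)
    refine (_root_.mul_eq_zero.1 (?_ : (koszulSign (deg a) (deg b) * W'.pairSign a b) *
      _ = 0)).resolve_left (mul_ne_zero (hunit a b).ne_zero (Units.ne_zero _))
    linear_combination h1 + f (D.fst a b, D.snd a b) * h2 +
      koszulSign (deg a) (deg b) * f (a, b) * h3
  -- In the converse direction, exchanged pairs cancel; at every other pair `f` or `r` vanishes,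
  -- because the null pairs of `W` and `W'` are complementary there.
  · refine sum_eq_zero_of_exchange (D := D) _ (fun a b h => ?_) fun a b h => ?_
    · by_cases hn : W.NullPair a b
      · rw [hf.1 a b h fun h' => ((hnull a b).1 h').2 hn]
        simp
      · rw [hr.1 a b h hn]
        simp
    · have h1 := hf.2 a b h
      have h2 := hr.2 a b h
      have h3 := hsign a b h
      have h4 := Int.units_coe_mul_self (W'.pairSign a b)
      simp only
      linear_combination koszulSign (deg (D.fst a b)) (deg (D.snd a b)) *
          r (D.fst a b, D.snd a b) * h1 -
        koszulSign (deg (D.fst a b)) (deg (D.snd a b)) * W'.pairSign a b * f (a, b) * h2 +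
        W'.pairSign a b * f (a, b) * r (a, b) * h3 -
        koszulSign (deg a) (deg b) * f (a, b) * r (a, b) * h4

theorem isKoszulDual {W' : D.Twist} {A B : Type} [Ring A] [Ring B] {z : I → A} {x : I → B}
    (hz : W.Presents z) (hx : W'.Presents x) {deg deg' : I → ℤ}
    (hdeg : ∀ a, deg' a = -(deg a + 1))
    (hnull : ∀ a b, W'.NullPair a b ↔ ¬ D.CommPair a b ∧ ¬ W.NullPair a b)
    (hsign : ∀ a b, D.CommPair a b →
      koszulSign (deg (D.fst a b)) (deg (D.snd a b)) * W.pairSign a b =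
        - (koszulSign (deg a) (deg b) * W'.pairSign a b))
    (hunit : ∀ a b, IsUnit (koszulSign (deg a) (deg b))) :
    IsKoszulDual z deg x deg' := by
  refine ⟨hdeg, ?_⟩
  rw [hz.quadRelations_eq, perp_relations deg hnull hsign hunit]
  exact hx

end Twist

end Exchange


open scoped Pointwise

/-! ### Signs attached to integer exponents -/

section Signs

theorem sgn_mul (e f : ℤ) : sgn e * sgn f = sgn (e + f) := by
  rw [sgn, sgn, sgn, Int.negOnePow_add, Units.val_mul]

theorem sgn_congr {e f : ℤ} (h : Even (e - f)) : sgn e = sgn f :=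
  congrArg Units.val ((Int.negOnePow_eq_iff e f).2 h)

theorem isUnit_sgn (e : ℤ) : IsUnit (sgn e) := Units.isUnit _

theorem sgn_zero : sgn 0 = 1 := by simp [sgn]

theorem neg_sgn (e : ℤ) : -sgn e = sgn (e + 1) := by
  rw [sgn, sgn, Int.negOnePow_succ, Units.val_neg]

end Signs

/-! ### Intervals, reflections and their exchanges -/

section Intervals

variable {n : ℕ}

/-- The interval `b` is contained in `a`. -/
def IncPair.Sub (b a : IncPair n) : Prop := a.1.1 ≤ b.1.1 ∧ b.1.2 ≤ a.1.2

/-- The intervals `a` and `b` are disjoint. -/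
def IncPair.Apart (a b : IncPair n) : Prop := a.1.2 < b.1.1 ∨ b.1.2 < a.1.1

/-- The reflection of the interval `a`, as a permutation of all indices. -/
def IncPair.reflection (a : IncPair n) : Equiv.Perm (Fin n) :=
  Function.Involutive.toPerm
    (fun x => if h : a.1.1 ≤ x ∧ x ≤ a.1.2 then ⟨a.1.1 + a.1.2 - x, by
      have := a.1.2.2; have := h.1; have := h.2; simp only [Fin.le_def] at *; omega⟩ else x) (by
    intro x
    have := a.2
    simp only [Fin.le_def, Fin.lt_def, Fin.ext_iff] at *
    split_ifs <;> simp at * <;> omega)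

theorem IncPair.reflection_val (a : IncPair n) (x : Fin n) :
    (a.reflection x : ℕ) =
      if (a.1.1 : ℕ) ≤ x ∧ (x : ℕ) ≤ a.1.2 then (a.1.1 : ℕ) + a.1.2 - x else x := by
  change ((if h : a.1.1 ≤ x ∧ x ≤ a.1.2 then (⟨a.1.1 + a.1.2 - x, _⟩ : Fin n) else x : Fin n) : ℕ)
    = _
  simp only [Fin.le_def]
  split_ifs <;> rfl

theorem IncPair.reflection_inv (a : IncPair n) : a.reflection⁻¹ = a.reflection := rfl

/-- The image of the interval `b` under the reflection of `a`, for `b` contained in `a`. -/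
def IncPair.reflect (a b : IncPair n) : IncPair n :=
  if h : a.1.1 ≤ b.1.1 ∧ b.1.2 ≤ a.1.2 then
    ⟨(⟨a.1.1 + a.1.2 - b.1.2, by
      have := a.1.2.2; have := h.1; have := h.2; have := b.2
      simp only [Fin.le_def, Fin.lt_def] at *; omega⟩,
      ⟨a.1.1 + a.1.2 - b.1.1, by
      have := a.1.2.2; have := h.1; have := h.2; have := b.2
      simp only [Fin.le_def, Fin.lt_def] at *; omega⟩), by
      have := h.1; have := h.2; have := b.2
      simp only [Fin.le_def, Fin.lt_def] at *; omega⟩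
  else b

theorem IncPair.reflect_of_not {a b : IncPair n} (h : ¬ b.Sub a) : a.reflect b = b := dif_neg h

theorem IncPair.reflect_fst {a b : IncPair n} (h : b.Sub a) :
    ((a.reflect b).1.1 : ℕ) = a.1.1 + a.1.2 - b.1.2 := by
  rw [reflect, dif_pos (show _ ∧ _ from h)]

theorem IncPair.reflect_snd {a b : IncPair n} (h : b.Sub a) :
    ((a.reflect b).1.2 : ℕ) = a.1.1 + a.1.2 - b.1.1 := by
  rw [reflect, dif_pos (show _ ∧ _ from h)]

theorem IncPair.ext_val {a b : IncPair n} (h1 : (a.1.1 : ℕ) = b.1.1) (h2 : (a.1.2 : ℕ) = b.1.2) :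
    a = b := Subtype.ext (Prod.ext (Fin.ext h1) (Fin.ext h2))

/-- The indices in the interval. -/
def IncPair.supp (a : IncPair n) : Set (Fin n) := Set.Icc a.1.1 a.1.2

theorem IncPair.supp_subset_iff {a b : IncPair n} : b.supp ⊆ a.supp ↔ b.Sub a :=
  Set.Icc_subset_Icc_iff b.2.le

theorem IncPair.supp_disjoint_iff {a b : IncPair n} : Disjoint a.supp b.supp ↔ a.Apart b := by
  have := a.2
  have := b.2
  rw [Set.disjoint_left]
  constructor
  · intro h
    have h1 := @h a.1.1
    have h2 := @h b.1.1
    simp only [supp, Set.mem_Icc, Apart, Fin.le_def, Fin.lt_def] at *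
    omega
  · intro h x hx hx'
    simp only [supp, Set.mem_Icc, Apart, Fin.le_def, Fin.lt_def] at *
    omega

theorem IncPair.supp_injective : Function.Injective (IncPair.supp (n := n)) := by
  intro a b h
  have h1 : a.Sub b := supp_subset_iff.1 h.subset
  have h2 : b.Sub a := supp_subset_iff.1 h.symm.subset
  exact Subtype.ext (Prod.ext (le_antisymm h2.1 h1.1) (le_antisymm h1.2 h2.2))

theorem IncPair.ncard_supp (a : IncPair n) : (a.supp.ncard : ℤ) = a.1.2 - a.1.1 + 1 := by
  have := a.2
  rw [supp, Set.ncard_eq_toFinset_card', Set.toFinset_Icc, Fin.card_Icc]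
  simp only [Fin.lt_def] at this
  omega

theorem IncPair.reflection_smul_self (a : IncPair n) : a.reflection • a.supp = a.supp := by
  ext x
  rw [Set.mem_smul_set_iff_inv_smul_mem, reflection_inv, Equiv.Perm.smul_def]
  have := a.reflection_val x
  have := a.2
  simp only [supp, Set.mem_Icc, Fin.le_def, Fin.lt_def] at *
  split_ifs at * <;> omega

theorem IncPair.reflection_smul {a b : IncPair n} (h : b.Sub a ∨ a.Sub b ∨ a.Apart b) :
    a.reflection • b.supp = (a.reflect b).supp := by
  ext x
  rw [Set.mem_smul_set_iff_inv_smul_mem, reflection_inv, Equiv.Perm.smul_def]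
  have hx := a.reflection_val x
  have ha := a.2
  have hb := b.2
  by_cases hs : b.Sub a
  · have h1 := reflect_fst hs
    have h2 := reflect_snd hs
    simp only [supp, Set.mem_Icc, Fin.le_def, Fin.lt_def, Sub, h1, h2] at *
    split_ifs at * <;> omega
  · rw [reflect_of_not hs]
    replace h := h.resolve_left hs
    simp only [supp, Set.mem_Icc, Fin.le_def, Fin.lt_def, Sub, Apart] at *
    split_ifs at * <;> omega

/-- The reflection of the image of `b` is the conjugate of the reflection of `b` by that of `a`; for
disjoint intervals the two reflections commute. -/
theorem IncPair.reflection_mul {a b : IncPair n} (h : b.Sub a ∨ a.Apart b) :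
    (a.reflect b).reflection * a.reflection = a.reflection * b.reflection := by
  ext x
  rw [Equiv.Perm.mul_apply, Equiv.Perm.mul_apply, reflection_val, reflection_val, reflection_val,
    reflection_val]
  have ha := a.2
  have hb := b.2
  by_cases hs : b.Sub a
  · rw [reflect_fst hs, reflect_snd hs]
    simp only [Fin.le_def, Fin.lt_def, Sub] at *
    split_ifs <;> omega
  · rw [reflect_of_not hs]
    replace h := h.resolve_left hs
    simp only [Fin.lt_def, Apart] at *
    split_ifs <;> omega

/-- Two sets are nested or disjoint. -/
def Laminar (A B : Set (Fin n)) : Prop := A ⊆ B ∨ B ⊆ A ∨ Disjoint A B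

theorem Laminar.symm {A B : Set (Fin n)} (h : Laminar A B) : Laminar B A := by
  rcases h with h | h | h
  exacts [Or.inr (Or.inl h), Or.inl h, Or.inr (Or.inr h.symm)]

theorem laminar_smul_iff (g : Equiv.Perm (Fin n)) {A B : Set (Fin n)} :
    Laminar (g • A) (g • B) ↔ Laminar A B := by
  simp only [Laminar, Set.smul_set_subset_smul_set_iff, Set.disjoint_smul_set]

/-- The reflection of `a` preserves the support of `a`, so it can be removed from any
permutation-invariant relation. This turns conditions on successive supports into conditions on the
intervals themselves. -/
theorem IncPair.smul_inv_right (a b : IncPair n) (P : Set (Fin n) → Set (Fin n) → Prop)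
    (hP : ∀ (g : Equiv.Perm (Fin n)) A B, P (g • A) (g • B) ↔ P A B) :
    P a.supp (a.reflection • b.supp) ↔ P a.supp b.supp := by
  conv_lhs => rw [← a.reflection_smul_self]
  exact hP _ _ _

theorem IncPair.laminar_iff {a b : IncPair n} :
    Laminar a.supp b.supp ↔ b.Sub a ∨ a.Sub b ∨ a.Apart b := by
  rw [Laminar, supp_subset_iff, supp_subset_iff, supp_disjoint_iff]
  tauto

theorem IncPair.Sub.antisymm {a b : IncPair n} (h : a.Sub b) (h' : b.Sub a) : a = b :=
  Subtype.ext (Prod.ext (le_antisymm h'.1 h.1) (le_antisymm h.2 h'.2))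

theorem IncPair.Apart.not_sub {a b : IncPair n} (h : a.Apart b) : ¬ b.Sub a := by
  have := a.2
  have := b.2
  simp only [Fin.le_def, Fin.lt_def, Apart, Sub] at *
  omega

theorem IncPair.Apart.symm {a b : IncPair n} (h : a.Apart b) : b.Apart a := Or.symm h

theorem IncPair.comm_aux {a b : IncPair n}
    (h : a.supp ≠ a.reflection • b.supp ∧ Laminar a.supp (a.reflection • b.supp)) :
    a ≠ b ∧ (b.Sub a ∨ a.Sub b ∨ a.Apart b) := by
  refine ⟨?_, IncPair.laminar_iff.1 ((a.smul_inv_right b Laminar fun g _ _ =>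
    laminar_smul_iff g).1 h.2)⟩
  rintro rfl
  exact h.1 a.reflection_smul_self.symm

theorem IncPair.Sub.reflect {a b : IncPair n} (h : b.Sub a) : (a.reflect b).Sub a := by
  have hb := b.2
  have h1 := reflect_fst h
  have h2 := reflect_snd h
  simp only [Fin.le_def, Fin.lt_def, Sub] at *
  omega

theorem IncPair.reflect_reflect {a b : IncPair n} (h : b.Sub a) : a.reflect (a.reflect b) = b := by
  apply IncPair.ext_val
  · rw [reflect_fst h.reflect, reflect_snd h]
    simp only [Fin.le_def, Sub] at *
    omega
  · rw [reflect_snd h.reflect, reflect_fst h]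
    simp only [Fin.le_def, Sub] at *
    omega

theorem IncPair.reflect_self (a : IncPair n) : a.reflect a = a := by
  have h : a.Sub a := ⟨le_rfl, le_rfl⟩
  apply IncPair.ext_val
  · rw [reflect_fst h, Nat.add_sub_cancel]
  · rw [reflect_snd h, Nat.add_sub_cancel_left]

theorem IncPair.Sub.reflect_eq {a b : IncPair n} (h : b.Sub a) : b.reflect a = a := by
  by_cases h' : a.Sub b
  · rw [h.antisymm h', reflect_self]
  · exact reflect_of_not h'

/-- Exchanges of intervals: the word `a b` with `b` contained in `a` can be replaced by `b' a`,
where `b'` is the reflected interval, and letters with disjoint intervals commute. -/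
def intervalExchange (n : ℕ) : Exchange (IncPair n) (Set (Fin n)) (Equiv.Perm (Fin n)) where
  perm := IncPair.reflection
  supp := IncPair.supp
  supp_injective := IncPair.supp_injective
  Comm A B := A ≠ B ∧ Laminar A B
  comm_symm h := ⟨h.1.symm, h.2.symm⟩
  comm_irrefl _ h := h.1 rfl
  comm_smul g _ _ h := ⟨fun he => h.1 (smul_left_cancel g he), (laminar_smul_iff g).2 h.2⟩
  fst := IncPair.reflect
  snd a b := IncPair.reflect b a
  supp_fst h := (IncPair.reflection_smul (IncPair.comm_aux h).2).symm
  smul_supp_snd := by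
    intro a b h
    obtain ⟨hne, h⟩ := IncPair.comm_aux h
    rcases h with h | h | h
    · rw [h.reflect_eq, IncPair.reflection_smul (Or.inr (Or.inl h.reflect)), h.reflect.reflect_eq]
    · rw [h.reflect_eq, IncPair.reflection_smul (Or.inl h.reflect), IncPair.reflect_reflect h]
    · rw [IncPair.reflect_of_not h.not_sub, IncPair.reflect_of_not h.symm.not_sub,
        IncPair.reflection_smul (Or.inr (Or.inr h.symm)), IncPair.reflect_of_not h.symm.not_sub]
  perm_mul := by
    intro a b h
    obtain ⟨hne, h⟩ := IncPair.comm_aux h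
    rcases h with h | h | h
    · rw [h.reflect_eq, IncPair.reflection_mul (Or.inl h)]
    -- For `a` inside `b` the exchange is that of the contained case, read backwards.
    · rw [h.reflect_eq, ← IncPair.reflection_mul (Or.inl h.reflect), IncPair.reflect_reflect h]
    · rw [IncPair.reflect_of_not h.not_sub, IncPair.reflect_of_not h.symm.not_sub]
      have := IncPair.reflection_mul (Or.inr h)
      rwa [IncPair.reflect_of_not h.not_sub] at this

end Intervals


/-! ### The signs and null pairs of `Z` and `X`, and oriented generators -/

section Twists

variable {n : ℕ}

open Classical in
/-- The sign of the exchange of two nested or disjoint sets of letters, where `c` is the shift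
between `j - i` and the degree of a generator. -/
noncomputable def laminarSign (c : ℤ) (A B : Set (Fin n)) : ℤˣ :=
  if Disjoint A B then (((A.ncard : ℤ) - 1 - c) * ((B.ncard : ℤ) - 1 - c)).negOnePow
  -- The extra summand is the length of the inner interval: reflection reverses its endpoints, and
  -- restoring increasing order costs this sign.
  else (((A.ncard : ℤ) - 1 - c) * ((B.ncard : ℤ) - 1 - c) +
    min ((A.ncard : ℤ) - 1) ((B.ncard : ℤ) - 1)).negOnePow

theorem laminarSign_symm (c : ℤ) (A B : Set (Fin n)) : laminarSign c A B = laminarSign c B A := by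
  rw [laminarSign, laminarSign, disjoint_comm, mul_comm, min_comm]

theorem laminarSign_smul (c : ℤ) (g : Equiv.Perm (Fin n)) (A B : Set (Fin n)) :
    laminarSign c (g • A) (g • B) = laminarSign c A B := by
  rw [laminarSign, laminarSign, Set.ncard_smul_set, Set.ncard_smul_set]
  classical exact if_congr Set.disjoint_smul_set rfl rfl

/-- Signs and null pairs for `Z`. -/
noncomputable def zTwist (n : ℕ) : (intervalExchange n).Twist where
  sign := laminarSign 0
  sign_symm := laminarSign_symm 0
  sign_smul := laminarSign_smul 0
  Null A B := ¬ Laminar A B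
  null_smul g _ _ h := fun h' => h ((laminar_smul_iff g).1 h')
  not_comm_of_null _ _ h h' := h h'.2
  comm_or_null := by
    intro A B C h h'
    -- Non-laminar pairs are null, so only equality of `A` and `C` has to be excluded: `C` is
    -- laminar to `B` and `A` is not.
    by_cases hAC : Laminar A C
    · refine Or.inl ⟨?_, hAC⟩
      rintro rfl
      exact h h'.2
    · exact Or.inr hAC

/-- Signs and null pairs for `X`. -/
noncomputable def xTwist (n : ℕ) : (intervalExchange n).Twist where
  sign := laminarSign 1
  sign_symm := laminarSign_symm 1
  sign_smul := laminarSign_smul 1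
  Null A B := A = B
  null_smul g _ _ h := congrArg (g • ·) h
  not_comm_of_null _ _ h h' := h'.1 h
  comm_or_null := by
    rintro A B C rfl h
    exact Or.inl ⟨h.1.symm, h.2.symm⟩

/-- The length `j - i` of an interval. -/
def IncPair.len (a : IncPair n) : ℤ := (a.1.2 : ℤ) - a.1.1

theorem IncPair.len_reflect {a b : IncPair n} : (a.reflect b).len = b.len := by
  by_cases h : b.Sub a
  · have := a.2
    have := b.2
    rw [len, len, reflect_fst h, reflect_snd h]
    simp only [Sub, Fin.le_def, Fin.lt_def] at *
    omega
  · rw [reflect_of_not h]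

theorem IncPair.commPair_iff {a b : IncPair n} : (intervalExchange n).CommPair a b ↔
    a ≠ b ∧ (b.Sub a ∨ a.Sub b ∨ a.Apart b) := by
  refine ⟨comm_aux, fun h => ?_⟩
  change a.supp ≠ a.reflection • b.supp ∧ Laminar a.supp (a.reflection • b.supp)
  rw [a.smul_inv_right b (fun A B => A ≠ B) fun g _ _ => (smul_left_cancel_iff g).not,
    a.smul_inv_right b Laminar fun g _ _ => laminar_smul_iff g, laminar_iff]
  exact ⟨fun he => h.1 (supp_injective he), h.2⟩

theorem IncPair.laminarSign_reflection (c : ℤ) (a b : IncPair n) :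
    laminarSign c a.supp (a.reflection • b.supp) = laminarSign c a.supp b.supp := by
  conv_lhs => rw [← a.reflection_smul_self]
  rw [a.reflection_smul_self, ← laminarSign_smul c a.reflection a.supp b.supp,
    a.reflection_smul_self]

theorem IncPair.laminarSign_of_sub (c : ℤ) {a b : IncPair n} (h : b.Sub a) :
    (laminarSign c a.supp (a.reflection • b.supp) : ℤ) =
      sgn ((a.len - c) * (b.len - c) + b.len) := by
  rw [laminarSign_reflection, laminarSign, supp_disjoint_iff, if_neg fun h' => h'.not_sub h,
    ncard_supp, ncard_supp, sgn, add_sub_cancel_right, add_sub_cancel_right, min_eq_right]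
  · rfl
  · simp only [Sub, Fin.le_def] at h
    omega

theorem IncPair.laminarSign_of_apart (c : ℤ) {a b : IncPair n} (h : a.Apart b) :
    (laminarSign c a.supp (a.reflection • b.supp) : ℤ) = sgn ((a.len - c) * (b.len - c)) := by
  rw [laminarSign_reflection, laminarSign, supp_disjoint_iff, if_pos h,
    ncard_supp, ncard_supp, sgn, add_sub_cancel_right, add_sub_cancel_right]
  rfl

theorem zTwist_nullPair_iff {a b : IncPair n} :
    (zTwist n).NullPair a b ↔ ¬ (b.Sub a ∨ a.Sub b ∨ a.Apart b) := by
  change ¬ Laminar a.supp (a.reflection • b.supp) ↔ _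
  rw [a.smul_inv_right b Laminar fun g _ _ => laminar_smul_iff g, IncPair.laminar_iff]

theorem xTwist_nullPair_iff {a b : IncPair n} : (xTwist n).NullPair a b ↔ a = b := by
  change a.supp = a.reflection • b.supp ↔ _
  rw [a.smul_inv_right b (fun A B => A = B) fun g _ _ => smul_left_cancel_iff g,
    IncPair.supp_injective.eq_iff]

variable {B C : Type} [Ring B] [Ring C] {c : ℤ} {W : (intervalExchange n).Twist}

/-- It is enough to check the exchange relations for contained and disjoint intervals. -/
theorem mul_eq_of_commPair (hW : W.sign = laminarSign c) {x : IncPair n → B}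
    (hsub : ∀ a b, a ≠ b → b.Sub a →
      x a * x b = sgn ((a.len - c) * (b.len - c) + b.len) • (x (a.reflect b) * x a))
    (hap : ∀ a b, a.Apart b → x a * x b = sgn ((a.len - c) * (b.len - c)) • (x b * x a))
    (a b : IncPair n) (h : (intervalExchange n).CommPair a b) :
    x a * x b = (W.pairSign a b : ℤ) •
      (x ((intervalExchange n).fst a b) * x ((intervalExchange n).snd a b)) := by
  have key : ∀ a b, a ≠ b → b.Sub a → x a * x b = (W.pairSign a b : ℤ) •
      (x ((intervalExchange n).fst a b) * x ((intervalExchange n).snd a b)) := by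
    intro a b hne h
    change _ = (W.sign a.supp (a.reflection • b.supp) : ℤ) • (x (a.reflect b) * x (b.reflect a))
    rw [hW, IncPair.laminarSign_of_sub c h, h.reflect_eq]
    exact hsub a b hne h
  obtain ⟨hne, h1 | h1 | h1⟩ := IncPair.commPair_iff.1 h
  · exact key a b hne h1
  -- With `a` inside `b`, the relation is the contained case for `b` and the reflection of `a`,
  -- multiplied by its sign.
  · have h2 : (intervalExchange n).fst a b = b := h1.reflect_eq
    have h3 : (intervalExchange n).snd a b = b.reflect a := rfl
    have h4 := W.pairSign_swap h
    have h5 := h.fst_fst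
    have h6 := h.snd_snd
    rw [h2, h3] at h4 h5 h6 ⊢
    have hne' : b ≠ b.reflect a := by
      intro he
      apply hne
      rw [← IncPair.reflect_reflect h1, ← he, IncPair.reflect_self]
    rw [key b (b.reflect a) hne' h1.reflect, h5, h6, h4, smul_smul, Int.units_coe_mul_self,
      one_smul]
  · change _ = (W.sign a.supp (a.reflection • b.supp) : ℤ) • (x (a.reflect b) * x (b.reflect a))
    rw [hW, IncPair.laminarSign_of_apart c h1, IncPair.reflect_of_not h1.not_sub,
      IncPair.reflect_of_not h1.symm.not_sub]
    exact hap a b h1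

/-- The extension of a family indexed by pairs `i < j` to all pairs. -/
noncomputable def orient (x : IncPair n → B) (i j : Fin n) : B :=
  if h : i < j then x ⟨(i, j), h⟩ else if h : j < i then sgn ((j : ℤ) - i) • x ⟨(j, i), h⟩ else 0

theorem orient_of_lt (x : IncPair n → B) {i j : Fin n} (h : i < j) :
    orient x i j = x ⟨(i, j), h⟩ := dif_pos h

theorem orient_of_gt (x : IncPair n → B) {i j : Fin n} (h : j < i) :
    orient x i j = sgn ((j : ℤ) - i) • x ⟨(j, i), h⟩ := by
  rw [orient, dif_neg h.not_gt, dif_pos h]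

theorem orient_self (x : IncPair n → B) (i : Fin n) : orient x i i = 0 := by
  simp [orient]

theorem orient_reversal (x : IncPair n → B) (i j : Fin n) :
    orient x j i = sgn ((j : ℤ) - i) • orient x i j := by
  rcases lt_trichotomy i j with h | rfl | h
  · rw [orient_of_lt x h, orient_of_gt x h]
    congr 1
    exact sgn_congr ⟨(i : ℤ) - j, by ring⟩
  · rw [orient_self, smul_zero]
  · rw [orient_of_lt x h, orient_of_gt x h, smul_smul, sgn_mul,
      sgn_congr (f := 0) ⟨(j : ℤ) - i, by ring⟩, sgn_zero, one_smul]

theorem map_orient (f : B →+* C) (x : IncPair n → B) (i j : Fin n) :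
    f (orient x i j) = orient (fun a => f (x a)) i j := by
  rcases lt_trichotomy i j with h | rfl | h
  · rw [orient_of_lt _ h, orient_of_lt _ h]
  · rw [orient_self, orient_self, map_zero]
  · rw [orient_of_gt _ h, orient_of_gt _ h, map_zsmul]

theorem exists_orient (x : IncPair n → B) {i j : Fin n} (h : i ≠ j) :
    ∃ (p : IncPair n) (o : ℤ), orient x i j = sgn o • x p ∧ p.supp = Set.uIcc i j ∧
      ((o = 0 ∧ p.1.1 = i ∧ p.1.2 = j) ∨ (o = (j : ℤ) - i ∧ p.1.1 = j ∧ p.1.2 = i)) := by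
  rcases lt_or_gt_of_ne h with h | h
  · exact ⟨⟨(i, j), h⟩, 0, by rw [orient_of_lt x h, sgn_zero, one_smul],
      (Set.uIcc_of_le h.le).symm, Or.inl ⟨rfl, rfl, rfl⟩⟩
  · exact ⟨⟨(j, i), h⟩, _, orient_of_gt x h, (Set.uIcc_of_ge h.le).symm, Or.inr ⟨rfl, rfl, rfl⟩⟩

theorem even_shifted_mul_sub {d d' e e' : ℤ} (h : Even (d - e)) (h' : Even (d' - e')) (c : ℤ) :
    Even ((d - c) * (d' - c) - (e - c) * (e' - c)) := by
  rw [show (d - c) * (d' - c) - (e - c) * (e' - c) = (d - e) * (d' - c) + (e - c) * (d' - e') by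
    ring]
  exact (h.mul_right _).add (h'.mul_left _)

theorem orient_mul_reflection (hW : W.sign = laminarSign c) {x : IncPair n → B}
    (hx : ∀ a b, (intervalExchange n).CommPair a b → x a * x b = (W.pairSign a b : ℤ) •
      (x ((intervalExchange n).fst a b) * x ((intervalExchange n).snd a b)))
    (hself : c = 0 ∨ ∀ a, x a * x a = 0) {i j i' j' k l : Fin n} (h : i ≠ j) (h' : i' ≠ j')
    (hsub : Set.uIcc i' j' ⊆ Set.uIcc i j) (hk : (k : ℕ) + i' = i + j) (hl : (l : ℕ) + j' = i + j) :
    orient x i j * orient x i' j' =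
      sgn (((j : ℤ) - i - c) * ((j' : ℤ) - i' - c)) • (orient x k l * orient x i j) := by
  have hkl : k ≠ l := by
    rintro rfl
    exact h' (Fin.ext (by omega))
  obtain ⟨p, o, e1, hp, ho⟩ := exists_orient x h
  obtain ⟨q, o', e2, hq, ho'⟩ := exists_orient x h'
  obtain ⟨r, o'', e3, hr, ho''⟩ := exists_orient x hkl
  rw [← hp, ← hq, IncPair.supp_subset_iff] at hsub
  have hlen : p.reflect q = r := by
    have := p.2
    have := q.2
    have := r.2
    apply IncPair.ext_val
    · rw [IncPair.reflect_fst hsub]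
      simp only [Fin.ext_iff, Fin.lt_def] at *
      omega
    · rw [IncPair.reflect_snd hsub]
      simp only [Fin.ext_iff, Fin.lt_def] at *
      omega
  have hD : Even (p.len - ((j : ℤ) - i)) := by
    rw [IncPair.len, Int.even_iff]
    omega
  have hD' : Even (q.len - ((j' : ℤ) - i')) := by
    rw [IncPair.len, Int.even_iff]
    omega
  -- Reflection reverses orientation: exactly one of `q` and `r` carries a reversal sign, of parity
  -- `q.len`.
  have ho : Even (q.len + o' - o'') := by
    have := q.2
    have := r.2
    rw [IncPair.len, Int.even_iff]
    simp only [Fin.lt_def, Fin.ext_iff] at *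
    omega
  rw [e1, e2, e3, smul_mul_smul_comm, smul_mul_smul_comm, smul_smul]
  by_cases hpq : p = q
  · subst hpq
    rw [IncPair.reflect_self] at hlen
    subst hlen
    -- For equal intervals the relation has no content: when `c = 0` its total sign has even
    -- exponent, since `p.len * (p.len + 1)` is even, and otherwise both sides vanish.
    rcases hself with rfl | hself
    · congr 1
      simp only [sgn_mul]
      apply sgn_congr
      have h1 : Even (p.len * p.len + p.len) := by
        rw [← mul_add_one]
        exact Int.even_mul_succ_self _
      obtain ⟨m, hm⟩ := (ho.add (even_shifted_mul_sub hD hD' 0)).sub h1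
      exact ⟨m, by linear_combination hm⟩
    · rw [hself, smul_zero, smul_zero]
  · have hc : (intervalExchange n).CommPair p q := IncPair.commPair_iff.2 ⟨hpq, Or.inl hsub⟩
    rw [hx p q hc]
    change _ • ((W.sign p.supp (p.reflection • q.supp) : ℤ) • (x (p.reflect q) * x (q.reflect p))) =
      _
    rw [hW, IncPair.laminarSign_of_sub c hsub, hsub.reflect_eq, hlen, smul_smul]
    congr 1
    simp only [sgn_mul]
    apply sgn_congr
    obtain ⟨m, hm⟩ := ho.add (even_shifted_mul_sub hD hD' c)
    exact ⟨m, by linear_combination hm⟩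

theorem orient_mul_disjoint (hW : W.sign = laminarSign c) {x : IncPair n → B}
    (hx : ∀ a b, (intervalExchange n).CommPair a b → x a * x b = (W.pairSign a b : ℤ) •
      (x ((intervalExchange n).fst a b) * x ((intervalExchange n).snd a b)))
    {i j i' j' : Fin n} (h : i ≠ j) (h' : i' ≠ j')
    (hdisj : Disjoint (Set.uIcc i j) (Set.uIcc i' j')) :
    orient x i j * orient x i' j' =
      sgn (((j : ℤ) - i - c) * ((j' : ℤ) - i' - c)) • (orient x i' j' * orient x i j) := by
  obtain ⟨p, o, e1, hp, ho⟩ := exists_orient x h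
  obtain ⟨q, o', e2, hq, ho'⟩ := exists_orient x h'
  rw [← hp, ← hq, IncPair.supp_disjoint_iff] at hdisj
  have hpq : p ≠ q := by
    rintro rfl
    exact hdisj.not_sub ⟨le_rfl, le_rfl⟩
  have hc : (intervalExchange n).CommPair p q :=
    IncPair.commPair_iff.2 ⟨hpq, Or.inr (Or.inr hdisj)⟩
  rw [e1, e2, smul_mul_smul_comm, smul_mul_smul_comm, smul_smul, hx p q hc]
  change _ • ((W.sign p.supp (p.reflection • q.supp) : ℤ) • (x (p.reflect q) * x (q.reflect p))) =
    _
  rw [hW, IncPair.laminarSign_of_apart c hdisj, IncPair.reflect_of_not hdisj.not_sub,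
    IncPair.reflect_of_not hdisj.symm.not_sub, smul_smul]
  congr 1
  simp only [sgn_mul]
  apply sgn_congr
  have hD : Even (p.len - ((j : ℤ) - i)) := by
    rw [IncPair.len, Int.even_iff]
    omega
  have hD' : Even (q.len - ((j' : ℤ) - i')) := by
    rw [IncPair.len, Int.even_iff]
    omega
  obtain ⟨m, hm⟩ := even_shifted_mul_sub hD hD' c
  exact ⟨m, by linear_combination hm⟩

end Twists


/-! ### Presentations of `Z` and `X`, and the conclusion -/

section Presentations

variable {n : ℕ}

theorem IncPair.Sub.refl (a : IncPair n) : a.Sub a := ⟨le_rfl, le_rfl⟩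

/-- The reversal correction `m` does not depend on the shift `c`, so it cancels when the signs of
`Z` and `X` are compared. -/
theorem IncPair.exists_laminarSign_eq {a b : IncPair n} (h : (intervalExchange n).CommPair a b) :
    ∃ m : ℤ, ∀ c, (laminarSign c a.supp (a.reflection • b.supp) : ℤ) =
      sgn ((a.len - c) * (b.len - c) + m) := by
  obtain ⟨-, h | h | h⟩ := commPair_iff.1 h
  · exact ⟨_, fun c => laminarSign_of_sub c h⟩
  · refine ⟨a.len, fun c => ?_⟩
    rw [laminarSign_reflection, laminarSign_symm, ← laminarSign_reflection, laminarSign_of_sub c h,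
      mul_comm]
  · exact ⟨0, fun c => by rw [laminarSign_of_apart c h, add_zero]⟩

theorem IncPair.len_fst_snd (a b : IncPair n) : ((intervalExchange n).fst a b).len = b.len ∧
    ((intervalExchange n).snd a b).len = a.len := ⟨len_reflect, len_reflect⟩

theorem presents_of_ringHoms {I S G A : Type} [Group G] [MulAction G S] {D : Exchange I S G}
    [Fintype I] [Ring A] {W : D.Twist} {z : I → A}
    (h1 : ∀ a b, D.CommPair a b →
      z a * z b = (W.pairSign a b : ℤ) • (z (D.fst a b) * z (D.snd a b)))
    (h2 : ∀ a b, W.NullPair a b → z a * z b = 0)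
    (hlift : ∀ {B : Type} [Ring B] (x : I → B), (∀ a b, D.CommPair a b →
        x a * x b = (W.pairSign a b : ℤ) • (x (D.fst a b) * x (D.snd a b))) →
      (∀ a b, W.NullPair a b → x a * x b = 0) → ∃ f : A →+* B, ∀ a, f (z a) = x a)
    (hext : ∀ f : A →+* A, (∀ a, f (z a) = z a) → f = RingHom.id A) : W.Presents z := by
  classical
  let f : QuadAlg W.relations →+* A := QuadAlg.lift z fun r hr => W.quadEval_eq_zero z h1 h2 hr
  have hf : ∀ a, f (QuadAlg.gen _ a) = z a := QuadAlg.lift_gen z _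
  obtain ⟨g, hg⟩ := hlift (QuadAlg.gen W.relations)
    (fun a b h => by
      have h := QuadAlg.quadEval_gen (W.single_sub_mem_relations h)
      rwa [quadEval_sub_smul, quadEval_single, quadEval_single, sub_eq_zero] at h)
    (fun a b h => by
      have h := QuadAlg.quadEval_gen (W.single_mem_relations h)
      rwa [quadEval_single] at h)
  refine ⟨RingEquiv.ofRingHom f g (hext _ fun a => ?_) (QuadAlg.ringHom_ext fun a => ?_), hf⟩
  · rw [RingHom.comp_apply, hg, hf]
  · rw [RingHom.comp_apply, hf, hg, RingHom.id_apply]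

theorem zGen_reversal (i j : Fin n) (h : i ≠ j) :
    zGen j i h.symm = sgn ((j : ℤ) - i) • zGen i j h := by
  have := RingQuot.mkRingHom_rel (ZRel.reversal i j h)
  rwa [map_zsmul] at this

theorem zGen_eq_orient (i j : Fin n) (h : i ≠ j) : zGen i j h = orient (zInc n) i j := by
  rcases lt_or_gt_of_ne h with h' | h'
  · rw [orient_of_lt _ h']
    rfl
  · rw [orient_of_gt _ h', zGen_reversal j i h.symm]
    rw [zInc]
    congr 1
    exact sgn_congr ⟨(i : ℤ) - j, by ring⟩

theorem zInc_mul_of_sub {a b : IncPair n} (h : b.Sub a) :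
    zInc n a * zInc n b = sgn (a.len * b.len + b.len) • (zInc n (a.reflect b) * zInc n a) := by
  have h1 := IncPair.reflect_fst h
  have h2 := IncPair.reflect_snd h
  have hlen := IncPair.len_reflect (a := a) (b := b)
  have hlt := (a.reflect b).2
  have ha := a.2
  have hb := b.2
  have hs := h
  simp only [IncPair.Sub, Fin.le_def, Fin.lt_def] at hs ha hb
  have key := RingQuot.mkRingHom_rel (ZRel.reflection a.1.1 a.1.2 b.1.1 b.1.2 (a.reflect b).1.2
    (a.reflect b).1.1 a.2.ne b.2.ne hlt.ne' (by
      rw [Set.uIcc_of_le a.2.le, Set.uIcc_of_le b.2.le]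
      exact IncPair.supp_subset_iff.2 h) (by omega) (by omega))
  rw [map_mul, map_zsmul, map_mul] at key
  have key' : zInc n a * zInc n b = sgn (a.len * b.len) •
      (zGen (a.reflect b).1.2 (a.reflect b).1.1 hlt.ne' * zInc n a) := key
  rw [key', zGen_reversal _ _ hlt.ne, smul_mul_assoc, smul_smul, sgn_mul]
  rw [← hlen]
  rfl

theorem zInc_mul_of_apart {a b : IncPair n} (h : a.Apart b) :
    zInc n a * zInc n b = sgn (a.len * b.len) • (zInc n b * zInc n a) := by
  have key := RingQuot.mkRingHom_rel (ZRel.disjoint a.1.1 a.1.2 b.1.1 b.1.2 a.2.ne b.2.ne (by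
      rw [Set.uIcc_of_le a.2.le, Set.uIcc_of_le b.2.le]
      exact IncPair.supp_disjoint_iff.2 h))
  rw [map_mul, map_zsmul, map_mul] at key
  exact key

theorem zInc_mul_of_nullPair {a b : IncPair n} (h : (zTwist n).NullPair a b) :
    zInc n a * zInc n b = 0 := by
  rw [zTwist_nullPair_iff, not_or, not_or] at h
  have key := RingQuot.mkRingHom_rel (ZRel.overlap a.1.1 a.1.2 b.1.1 b.1.2 a.2.ne b.2.ne
    (by
      rw [Set.uIcc_of_le a.2.le, Set.uIcc_of_le b.2.le]
      exact fun h' => h.2.2 (IncPair.supp_disjoint_iff.1 h'))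
    (by
      rw [Set.uIcc_of_le a.2.le, Set.uIcc_of_le b.2.le]
      exact fun h' => h.1 (IncPair.supp_subset_iff.1 h'))
    (by
      rw [Set.uIcc_of_le a.2.le, Set.uIcc_of_le b.2.le]
      exact fun h' => h.2.1 (IncPair.supp_subset_iff.1 h')))
  rw [map_mul, map_zero] at key
  exact key

/-- The family is extended to all ordered pairs by `orient`, which builds in the reversal relation;
the other relations then follow from those on increasing pairs. -/
theorem exists_ringHom_Z {B : Type} [Ring B] (x : IncPair n → B)
    (h1 : ∀ a b, (intervalExchange n).CommPair a b → x a * x b = ((zTwist n).pairSign a b : ℤ) •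
      (x ((intervalExchange n).fst a b) * x ((intervalExchange n).snd a b)))
    (h2 : ∀ a b, (zTwist n).NullPair a b → x a * x b = 0) :
    ∃ f : Z n →+* B, ∀ a, f (zInc n a) = x a := by
  let φ : FreeAlgebra ℤ (DistinctPair n) →+* B :=
    (FreeAlgebra.lift ℤ (fun p : DistinctPair n => orient x p.1.1 p.1.2) :
      FreeAlgebra ℤ (DistinctPair n) →ₐ[ℤ] B)
  have hφ : ∀ i j h, φ (zSym i j h) = orient x i j := by
    intro i j h
    simp [φ, zSym]
  have hrel : ∀ ⦃u v⦄, ZRel n u v → φ u = φ v := by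
    rintro _ _ (⟨i, j, h⟩ | ⟨i, j, i', j', k, l, h, h', hkl, hsub, hk, hl⟩ |
      ⟨i, j, i', j', h, h', hdisj⟩ | ⟨i, j, i', j', h, h', hmeet, hsub, hsup⟩)
    · rw [map_zsmul, hφ, hφ, orient_reversal]
    · rw [map_zsmul, map_mul, map_mul, hφ, hφ, hφ]
      simpa using orient_mul_reflection (W := zTwist n) (c := 0) rfl h1 (Or.inl rfl) h h' hsub hk hl
    · rw [map_zsmul, map_mul, map_mul, hφ, hφ]
      simpa using orient_mul_disjoint (W := zTwist n) (c := 0) rfl h1 h h' hdisj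
    · rw [map_mul, map_zero, hφ, hφ]
      obtain ⟨p, o, e1, hp, -⟩ := exists_orient x h
      obtain ⟨q, o', e2, hq, -⟩ := exists_orient x h'
      rw [← hp, ← hq] at hmeet hsub hsup
      rw [IncPair.supp_disjoint_iff] at hmeet
      rw [IncPair.supp_subset_iff] at hsub hsup
      rw [e1, e2, smul_mul_smul_comm, h2 p q (zTwist_nullPair_iff.2 (by tauto)), smul_zero]
  refine ⟨RingQuot.lift ⟨φ, hrel⟩, fun a => ?_⟩
  refine (RingQuot.lift_mkRingHom_apply _ _ _).trans ?_
  rw [hφ, orient_of_lt x a.2]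

theorem Z_presents (n : ℕ) : (zTwist n).Presents (zInc n) := by
  refine presents_of_ringHoms ?_ (fun a b => zInc_mul_of_nullPair) exists_ringHom_Z ?_
  · refine mul_eq_of_commPair (c := 0) rfl (fun a b _ h => ?_) fun a b h => ?_
    · simpa using zInc_mul_of_sub h
    · simpa using zInc_mul_of_apart h
  · intro f hf
    refine RingQuot.ringQuot_ext _ _ (freeAlgebra_ringHom_ext fun p => ?_)
    change f (zGen p.1.1 p.1.2 p.2) = zGen p.1.1 p.1.2 p.2
    rw [zGen_eq_orient, map_orient]
    simp only [hf]

theorem xGen_reversal (i j : Fin n) : xGen j i = sgn ((j : ℤ) - i) • xGen i j := by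
  have := RingQuot.mkRingHom_rel (XRel.reversal i j)
  rwa [map_zsmul] at this

theorem xGen_eq_orient (i j : Fin n) : xGen i j = orient (xInc n) i j := by
  rcases lt_trichotomy i j with h | rfl | h
  · rw [orient_of_lt _ h]
    rfl
  · have := RingQuot.mkRingHom_rel (XRel.diagonal i)
    rw [map_zero] at this
    rw [orient_self]
    exact this
  · rw [orient_of_gt _ h, xGen_reversal j i]
    rw [xInc]
    congr 1
    exact sgn_congr ⟨(i : ℤ) - j, by ring⟩

theorem xInc_mul_of_sub {a b : IncPair n} (h : b.Sub a) :
    xInc n a * xInc n b =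
      sgn ((a.len - 1) * (b.len - 1) + b.len) • (xInc n (a.reflect b) * xInc n a) := by
  have h1 := IncPair.reflect_fst h
  have h2 := IncPair.reflect_snd h
  have hlen := IncPair.len_reflect (a := a) (b := b)
  have ha := a.2
  have hb := b.2
  have hs := h
  simp only [IncPair.Sub, Fin.le_def, Fin.lt_def] at hs ha hb
  have key := RingQuot.mkRingHom_rel (XRel.reflection a.1.1 a.1.2 b.1.1 b.1.2 (a.reflect b).1.2
    (a.reflect b).1.1 (by
      rw [Set.uIcc_of_le a.2.le, Set.uIcc_of_le b.2.le]
      exact IncPair.supp_subset_iff.2 h) (by omega) (by omega))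
  rw [map_mul, map_zsmul, map_mul] at key
  have key' : xInc n a * xInc n b = sgn ((a.len - 1) * (b.len - 1)) •
      (xGen (a.reflect b).1.2 (a.reflect b).1.1 * xInc n a) := key
  rw [key', xGen_reversal, smul_mul_assoc, smul_smul, sgn_mul]
  rw [← hlen]
  rfl

theorem xInc_mul_of_apart {a b : IncPair n} (h : a.Apart b) :
    xInc n a * xInc n b = sgn ((a.len - 1) * (b.len - 1)) • (xInc n b * xInc n a) := by
  have key := RingQuot.mkRingHom_rel (XRel.disjoint a.1.1 a.1.2 b.1.1 b.1.2 (by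
      rw [Set.uIcc_of_le a.2.le, Set.uIcc_of_le b.2.le]
      exact IncPair.supp_disjoint_iff.2 h))
  rw [map_mul, map_zsmul, map_mul] at key
  exact key

theorem xInc_mul_self (a : IncPair n) : xInc n a * xInc n a = 0 := by
  have key := RingQuot.mkRingHom_rel (XRel.square a.1.1 a.1.2)
  rw [map_pow, map_zero, sq] at key
  exact key

theorem exists_ringHom_X {B : Type} [Ring B] (x : IncPair n → B)
    (h1 : ∀ a b, (intervalExchange n).CommPair a b → x a * x b = ((xTwist n).pairSign a b : ℤ) •
      (x ((intervalExchange n).fst a b) * x ((intervalExchange n).snd a b)))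
    (h2 : ∀ a b, (xTwist n).NullPair a b → x a * x b = 0) :
    ∃ f : X n →+* B, ∀ a, f (xInc n a) = x a := by
  let φ : FreeAlgebra ℤ (Fin n × Fin n) →+* B :=
    (FreeAlgebra.lift ℤ (fun p : Fin n × Fin n => orient x p.1 p.2) :
      FreeAlgebra ℤ (Fin n × Fin n) →ₐ[ℤ] B)
  have hφ : ∀ i j, φ (xSym i j) = orient x i j := by
    intro i j
    simp [φ, xSym]
  have hself : ∀ a, x a * x a = 0 := fun a => h2 a a (xTwist_nullPair_iff.2 rfl)
  have hrel : ∀ ⦃u v⦄, XRel n u v → φ u = φ v := by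
    rintro _ _ (⟨i, j⟩ | ⟨i⟩ | ⟨i, j⟩ | ⟨i, j, i', j', k, l, hsub, hk, hl⟩ |
      ⟨i, j, i', j', hdisj⟩)
    · rw [map_zsmul, hφ, hφ, orient_reversal]
    · rw [hφ, orient_self, map_zero]
    · rw [map_pow, map_zero, hφ, sq]
      by_cases h : i = j
      · rw [h, orient_self, zero_mul]
      · obtain ⟨p, o, e1, -, -⟩ := exists_orient x h
        rw [e1, smul_mul_smul_comm, hself, smul_zero]
    · rw [map_zsmul, map_mul, map_mul, hφ, hφ, hφ]
      by_cases h : i = j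
      · rw [h, orient_self, zero_mul, mul_zero, smul_zero]
      by_cases h' : i' = j'
      -- A one-point inner interval has a one-point reflection, so both sides contain a zero
      -- generator.
      · have : k = l := Fin.ext (by rw [h'] at hk; omega)
        rw [h', this, orient_self, orient_self, zero_mul, mul_zero, smul_zero]
      exact orient_mul_reflection (W := xTwist n) rfl h1 (Or.inr hself) h h' hsub hk hl
    · rw [map_zsmul, map_mul, map_mul, hφ, hφ]
      by_cases h : i = j
      · rw [h, orient_self, zero_mul, mul_zero, smul_zero]
      by_cases h' : i' = j'
      · rw [h', orient_self, zero_mul, mul_zero, smul_zero]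
      exact orient_mul_disjoint (W := xTwist n) rfl h1 h h' hdisj
  refine ⟨RingQuot.lift ⟨φ, hrel⟩, fun a => ?_⟩
  refine (RingQuot.lift_mkRingHom_apply _ _ _).trans ?_
  rw [hφ, orient_of_lt x a.2]

theorem X_presents (n : ℕ) : (xTwist n).Presents (xInc n) := by
  refine presents_of_ringHoms ?_ (fun a b h => ?_) exists_ringHom_X ?_
  · exact mul_eq_of_commPair (c := 1) rfl (fun a b _ h => xInc_mul_of_sub h)
      fun a b h => xInc_mul_of_apart h
  · rw [xTwist_nullPair_iff.1 h, xInc_mul_self]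
  · intro f hf
    refine RingQuot.ringQuot_ext _ _ (freeAlgebra_ringHom_ext fun p => ?_)
    change f (xGen p.1 p.2) = xGen p.1 p.2
    rw [xGen_eq_orient, map_orient]
    simp only [hf]

theorem zIncDegree_eq (a : IncPair n) : zIncDegree n a = -a.len := by
  have := a.2
  rw [zIncDegree, zDegree, IncPair.len, abs_of_nonneg]
  simp only [Fin.lt_def] at this
  omega

theorem xIncDegree_eq (a : IncPair n) : xIncDegree n a = a.len - 1 := by
  have := a.2
  rw [xIncDegree, xDegree, IncPair.len, abs_of_nonneg]
  simp only [Fin.lt_def] at this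
  omega

theorem isUnit_koszulSign (p q : ℤ) : IsUnit (koszulSign p q) :=
  (isUnit_sgn _).mul (isUnit_sgn _)

theorem koszulDual_Z_X (n : ℕ) :
    IsKoszulDual (zInc n) (zIncDegree n) (xInc n) (xIncDegree n) := by
  refine Exchange.Twist.isKoszulDual (Z_presents n) (X_presents n) (fun a => ?_)
    (fun a b => ?_) (fun a b h => ?_) fun a b => isUnit_koszulSign _ _
  · rw [zIncDegree_eq, xIncDegree_eq]
    ring
  · rw [xTwist_nullPair_iff, zTwist_nullPair_iff, IncPair.commPair_iff]
    -- Equal intervals are nested, hence not null for `Z`; so the three types of pairs are mutually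
    -- exclusive.
    have : a = b → b.Sub a := fun h => h ▸ IncPair.Sub.refl a
    tauto
  · obtain ⟨m, hm⟩ := IncPair.exists_laminarSign_eq h
    change koszulSign _ _ * (laminarSign 0 a.supp (a.reflection • b.supp) : ℤ) =
      -(koszulSign _ _ * (laminarSign 1 a.supp (a.reflection • b.supp) : ℤ))
    obtain ⟨h1, h2⟩ := a.len_fst_snd b
    simp only [zIncDegree_eq, h1, h2, hm, koszulSign, sgn_mul, neg_sgn]
    -- The witness is half the difference of the two exponents: the pairing signs and the shift from
    -- `c = 0` to `c = 1` together account for the minus sign.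
    exact sgn_congr ⟨a.len - 1, by ring⟩

theorem koszulDual_X_Z (n : ℕ) :
    IsKoszulDual (xInc n) (xIncDegree n) (zInc n) (zIncDegree n) := by
  refine Exchange.Twist.isKoszulDual (X_presents n) (Z_presents n) (fun a => ?_)
    (fun a b => ?_) (fun a b h => ?_) fun a b => isUnit_koszulSign _ _
  · rw [zIncDegree_eq, xIncDegree_eq]
    ring
  · rw [xTwist_nullPair_iff, zTwist_nullPair_iff, IncPair.commPair_iff]
    have : a = b → b.Sub a := fun h => h ▸ IncPair.Sub.refl a
    tauto
  · obtain ⟨m, hm⟩ := IncPair.exists_laminarSign_eq h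
    change koszulSign _ _ * (laminarSign 1 a.supp (a.reflection • b.supp) : ℤ) =
      -(koszulSign _ _ * (laminarSign 0 a.supp (a.reflection • b.supp) : ℤ))
    obtain ⟨h1, h2⟩ := a.len_fst_snd b
    simp only [xIncDegree_eq, h1, h2, hm, koszulSign, sgn_mul, neg_sgn]
    exact sgn_congr ⟨-a.len, by ring⟩

theorem isKoszul_Z (n : ℕ) : IsKoszul (zInc n) (zIncDegree n) :=
  (Z_presents n).isKoszul fun a b _ => by
    obtain ⟨h1, h2⟩ := a.len_fst_snd b
    rw [zIncDegree_eq, zIncDegree_eq, zIncDegree_eq, zIncDegree_eq, h1, h2, add_comm]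

theorem isKoszul_X (n : ℕ) : IsKoszul (xInc n) (xIncDegree n) :=
  (X_presents n).isKoszul fun a b _ => by
    obtain ⟨h1, h2⟩ := a.len_fst_snd b
    rw [xIncDegree_eq, xIncDegree_eq, xIncDegree_eq, xIncDegree_eq, h1, h2, add_comm]

end Presentations

end KoszulNil

theorem theorem1p2 (n : ℕ) :
    KoszulNil.IsKoszul (KoszulNil.zInc n) (KoszulNil.zIncDegree n) ∧
    KoszulNil.IsKoszul (KoszulNil.xInc n) (KoszulNil.xIncDegree n) ∧
    KoszulNil.IsKoszulDual (KoszulNil.zInc n) (KoszulNil.zIncDegree n)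
      (KoszulNil.xInc n) (KoszulNil.xIncDegree n) ∧
    KoszulNil.IsKoszulDual (KoszulNil.xInc n) (KoszulNil.xIncDegree n)
      (KoszulNil.zInc n) (KoszulNil.zIncDegree n) ∧
    Module.Free ℤ (KoszulNil.X n) :=
  ⟨KoszulNil.isKoszul_Z n, KoszulNil.isKoszul_X n, KoszulNil.koszulDual_Z_X n,
    KoszulNil.koszulDual_X_Z n, (KoszulNil.isKoszul_X n).free⟩
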